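/- Let $\mathcal H$ be a complex separable Hilbert space, let $\mathcal B_1(\mathcal H)$ be the ideal of trace class operators on $\mathcal H$ with the trace norm $\|T\|_1=\operatorname{tr}\big((T^*T)^{1/2}\big)$, and let $H_0$ be a (possibly unbounded) self-adjoint operator in $\mathcal H$ with domain $\operatorname{dom}(H_0)$. Let $(s_1,s_2)\subset\mathbb R$ be an open interval and let $\{V(s)\}_{s\in(s_1,s_2)}\subset\mathcal B_1(\mathcal H)$ be a family of self-adjoint trace class operators such that $V$ and its derivative $V'$ are continuously differentiable in $\mathcal B_1(\mathcal H)$-norm on $(s_1,s_2)$, and such that $V$ is concave in the sense that $$0\ge V''(s)\in\mathcal B_1(\mathcal H),\qquad s\in(s_1,s_2).$$ Put $H(s)=H_0+V(s)$, $\operatorname{dom}(H(s))=\operatorname{dom}(H_0)$, and let $E_{H(s)}(\cdot)$ be the projection-valued spectral measure of the self-adjoint operator $H(s)$. Then, for every $\mu\in\mathbb R$ and $s\in(s_1,s_2)$, the operator $V'(s)E_{H(s)}((-\infty,\mu))$ is trace class with real trace, and the function $$s\longmapsto \operatorname{tr}\big(V'(s)\,E_{H(s)}((-\infty,\mu))\big),\qquad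 s\in(s_1,s_2),$$ is nonincreasing. -/

import Mathlib

open Filter Topology MeasureTheory Set
open scoped ENNReal InnerProductSpace

noncomputable section

namespace TraceMonotonicity

variable {H : Type*} [NormedAddCommGroup H] [InnerProductSpace ℂ H] [CompleteSpace H]

/-! ### Trace class operators -/

/-- The index set of a fixed orthonormal (Hilbert) basis of `H`. -/
def basisIndex (H : Type*) [NormedAddCommGroup H] [InnerProductSpace ℂ H] [CompleteSpace H] :
    Set H :=
  (exists_hilbertBasis ℂ H).choose

/-- A fixed orthonormal (Hilbert) basis of `H`, used to evaluate traces. The trace of a trace class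
operator and the trace norm do not depend on it. -/
def stdBasis (H : Type*) [NormedAddCommGroup H] [InnerProductSpace ℂ H] [CompleteSpace H] :
    HilbertBasis (basisIndex H) ℂ H :=
  (exists_hilbertBasis ℂ H).choose_spec.choose

/-- The trace norm `‖T‖₁ = tr |T|`, where `|T| = (T* T)^{1/2}`, as an element of `[0, ∞]`. -/
def traceNorm (T : H →L[ℂ] H) : ℝ≥0∞ :=
  ∑' i, ENNReal.ofReal (RCLike.re ⟪stdBasis H i, CFC.abs T (stdBasis H i)⟫_ℂ)

/-- `T` belongs to the trace ideal `B₁(H)`. -/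
def IsTraceClass (T : H →L[ℂ] H) : Prop :=
  traceNorm T < ∞

/-- The trace of an operator (meaningful for trace class operators). -/
def opTrace (T : H →L[ℂ] H) : ℂ :=
  ∑' i, ⟪stdBasis H i, T (stdBasis H i)⟫_ℂ

/-- `F` is differentiable at `s` with respect to the trace norm, with derivative `F' ∈ B₁(H)`. -/
def HasTraceNormDerivAt (F : ℝ → H →L[ℂ] H) (F' : H →L[ℂ] H) (s : ℝ) : Prop :=
  IsTraceClass F' ∧
    Tendsto (fun h : ℝ => traceNorm (((h⁻¹ : ℝ) : ℂ) • (F (s + h) - F s) - F')) (𝓝[≠] 0) (𝓝 0)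

/-- On the open set `S`, `F` is a `B₁(H)`-valued function that is continuously differentiable in
trace norm, with derivative `F'`. -/
structure IsTraceNormC1On (F F' : ℝ → H →L[ℂ] H) (S : Set ℝ) : Prop where
  isTraceClass : ∀ s ∈ S, IsTraceClass (F s)
  hasDeriv : ∀ s ∈ S, HasTraceNormDerivAt F (F' s) s
  continuous_deriv : ∀ s ∈ S, Tendsto (fun t => traceNorm (F' t - F' s)) (𝓝[S] s) (𝓝 0)

/-! ### Spectral projections of (unbounded) self-adjoint operators -/

/-- A projection-valued measure on the Borel sets of `ℝ`: its values are orthogonal projections,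
it is normalized and strongly countably additive. Values on non-Borel sets are irrelevant. -/
structure ProjectionValuedMeasure (H : Type*) [NormedAddCommGroup H] [InnerProductSpace ℂ H]
    [CompleteSpace H] where
  proj : Set ℝ → H →L[ℂ] H
  isStarProjection : ∀ B, MeasurableSet B → IsStarProjection (proj B)
  proj_univ : proj univ = 1
  hasSum_iUnion : ∀ B : ℕ → Set ℝ, (∀ n, MeasurableSet (B n)) → Pairwise (Function.onFun Disjoint B) →
    ∀ x : H, HasSum (fun n => proj (B n) x) (proj (⋃ n, B n) x)

namespace ProjectionValuedMeasure

theorem proj_empty (E : ProjectionValuedMeasure H) (x : H) : E.proj ∅ x = 0 := by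
  have h := E.hasSum_iUnion (fun _ => ∅) (fun _ => MeasurableSet.empty)
    (fun _ _ _ => by simp [Function.onFun]) x
  exact (summable_const_iff _).1 h.summable

theorem inner_nonneg (E : ProjectionValuedMeasure H) (x : H) {B : Set ℝ} (hB : MeasurableSet B) :
    0 ≤ RCLike.re ⟪x, E.proj B x⟫_ℂ :=
  ((ContinuousLinearMap.nonneg_iff_isPositive _).1
    (E.isStarProjection B hB).nonneg).re_inner_nonneg_right x

/-- The finite positive Borel measure `B ↦ ⟪x, E(B) x⟫`. -/
def measure (E : ProjectionValuedMeasure H) (x : H) : Measure ℝ :=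
  Measure.ofMeasurable (fun B _ => ENNReal.ofReal (RCLike.re ⟪x, E.proj B x⟫_ℂ))
    (by simp [E.proj_empty])
    (by
      intro B hB hd
      have h := E.hasSum_iUnion B hB hd x
      have h2 : HasSum (fun n => RCLike.re ⟪x, E.proj (B n) x⟫_ℂ)
          (RCLike.re ⟪x, E.proj (⋃ n, B n) x⟫_ℂ) := by
        have := h.mapL ((innerSL ℂ x))
        simpa using RCLike.hasSum_re ℂ this
      rw [← h2.tsum_eq]
      exact ENNReal.ofReal_tsum_of_nonneg (fun n => E.inner_nonneg x (hB n)) h2.summable)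

/-- `E` is the spectral measure of the operator `A`, that is `A = ∫ λ dE(λ)`: the domain of `A` is
`{x | ∫ λ² d⟪x, E(λ) x⟫ < ∞}` and `⟪x, A x⟫ = ∫ λ d⟪x, E(λ) x⟫` on it. -/
structure IsSpectralMeasureOf (E : ProjectionValuedMeasure H) (A : H →ₗ.[ℂ] H) : Prop where
  mem_domain_iff : ∀ x : H, x ∈ A.domain ↔ Integrable (fun l : ℝ => l ^ 2) (E.measure x)
  inner_apply : ∀ x : A.domain, ⟪(x : H), A x⟫_ℂ = ((∫ l : ℝ, l ∂(E.measure (x : H)) : ℝ) : ℂ)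

end ProjectionValuedMeasure

open scoped Classical in
/-- The spectral projection `E_A(B)`. By the spectral theorem a self-adjoint `A` has exactly one
spectral measure, so that the default value `0` is never used for such `A`. -/
def spectralProjection (A : H →ₗ.[ℂ] H) (B : Set ℝ) : H →L[ℂ] H :=
  if h : ∃ E : ProjectionValuedMeasure H, E.IsSpectralMeasureOf A then h.choose.proj B else 0

/-- The operator `H₀ + W` with domain `dom H₀`, for a bounded operator `W`. -/
def perturb (H₀ : H →ₗ.[ℂ] H) (W : H →L[ℂ] H) : H →ₗ.[ℂ] H :=
  (W : H →ₗ[ℂ] H) +ᵥ H₀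

end TraceMonotonicity

end

/-! For `s < t` put `A = H(s)`, `B = H(t)`, `W = V(t) - V(s)`, so that `B = A + W`, and let `P`,
`P'` be the spectral projections of `A`, `B` below `μ`. Concavity gives `(t - s) V'(t) ≤ W ≤ (t - s)
V'(s)`, hence `(t - s) tr(V'(t) P') ≤ tr(W P')` and `tr(W P) ≤ (t - s) tr(V'(s) P)`. What remains is
`tr(W (P - P')) ≥ 0`, which is `re_diagSum_mul_proj_sub_nonneg`.

Since `P - P' = P (1 - P') - (1 - P) P'`, and exchanging `A` and `B` replaces `W` by `-W`, it
suffices that `Re tr(W P Q) ≥ 0` for `Q = 1 - P'`. Heuristically, `Q W P = Q B P - Q A P` with `B ≥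
μ` on the range of `Q` and `A < μ` on the range of `P`. To make this rigorous, `P` is cut into
dyadic windows `F` of `A`, whose width is comparable to their distance from `μ`. On one window `A`
is a scalar `c` plus an error of norm at most `(μ - c) / 3`. The operator `S = Q F` then satisfies a
coercive inequality that makes it Hilbert–Schmidt and its pairing with `Q W F` nonnegative
(`re_diagSum_window_nonneg`).

Traces are handled by writing a self-adjoint trace class operator as `K * K - L * L` with
Hilbert–Schmidt `K`, `L`. The spectral theorem for unbounded operators is proved through the normal
resolvent `(A + i)⁻¹` and its continuous functional calculus
(`IsMaximalSymmetric.exists_isSpectralMeasureOf`). -/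

noncomputable section

namespace TraceMonotonicity

variable {H : Type*} [NormedAddCommGroup H] [InnerProductSpace ℂ H] [CompleteSpace H]

/-! ### Hilbert–Schmidt operators -/

section HilbertSchmidt

set_option linter.unusedSectionVars false

variable {ι : Type*}

theorem hasSum_norm_inner_sq (b : HilbertBasis ι ℂ H) (x : H) :
    HasSum (fun j => ‖⟪b j, x⟫_ℂ‖ ^ 2) (‖x‖ ^ 2) := by
  have h := RCLike.hasSum_re ℂ (b.hasSum_inner_mul_inner x x)
  rw [inner_self_eq_norm_sq (𝕜 := ℂ)] at h
  convert h using 2 with i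
  rw [inner_mul_symm_re_eq_norm, norm_mul, norm_inner_symm, sq]

/-- `T` is a Hilbert–Schmidt operator (with respect to the Hilbert basis `b`). -/
def IsHS (b : HilbertBasis ι ℂ H) (T : H →L[ℂ] H) : Prop :=
  Summable fun i => ‖T (b i)‖ ^ 2

/-- The square of the Hilbert–Schmidt norm. -/
def hsSq (b : HilbertBasis ι ℂ H) (T : H →L[ℂ] H) : ℝ :=
  ∑' i, ‖T (b i)‖ ^ 2

variable {b : HilbertBasis ι ℂ H} {S T : H →L[ℂ] H}

theorem IsHS.summable (h : IsHS b T) : Summable fun i => ‖T (b i)‖ ^ 2 := h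

theorem hsSq_nonneg : 0 ≤ hsSq b T := tsum_nonneg fun _ => by positivity

/-- By Parseval, square summability of the columns is that of the whole matrix; exchanging rows and
columns then gives the statements about the adjoint. -/
theorem IsHS.summable_prod (h : IsHS b T) :
    Summable fun p : ι × ι => ‖⟪b p.2, T (b p.1)⟫_ℂ‖ ^ 2 := by
  refine (summable_prod_of_nonneg fun _ => by positivity).2 ⟨fun i => ?_, ?_⟩
  · exact (hasSum_norm_inner_sq b (T (b i))).summable
  · simpa only [(hasSum_norm_inner_sq b _).tsum_eq] using h.summable

theorem norm_inner_star (x y : H) : ‖⟪x, star T y⟫_ℂ‖ = ‖⟪y, T x⟫_ℂ‖ := by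
  rw [ContinuousLinearMap.star_eq_adjoint, ContinuousLinearMap.adjoint_inner_right,
    norm_inner_symm]

protected theorem IsHS.star (h : IsHS b T) : IsHS b (star T) := by
  have h' := h.summable_prod.prod_symm
  have := ((summable_prod_of_nonneg fun _ => by positivity).1 h').2
  simp only [Prod.swap, ← norm_inner_star (T := T), (hasSum_norm_inner_sq b _).tsum_eq] at this
  exact this

theorem IsHS.hsSq_star (h : IsHS b T) : hsSq b (Star.star T) = hsSq b T := by
  have := Summable.tsum_comm (f := fun i j => ‖⟪b j, T (b i)⟫_ℂ‖ ^ 2) h.summable_prod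
  simp only [(hasSum_norm_inner_sq b _).tsum_eq] at this
  simp only [← norm_inner_star (T := T), (hasSum_norm_inner_sq b _).tsum_eq] at this
  exact this

theorem IsHS.of_le {f : ι → ℝ} (hf : Summable f) (h : ∀ i, ‖T (b i)‖ ^ 2 ≤ f i) : IsHS b T :=
  Summable.of_nonneg_of_le (fun _ => by positivity) h hf

theorem norm_mul_apply_sq_le (C : H →L[ℂ] H) (x : H) :
    ‖(C * T) x‖ ^ 2 ≤ ‖C‖ ^ 2 * ‖T x‖ ^ 2 := by
  rw [← mul_pow]
  gcongr
  exact C.le_opNorm _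

protected theorem IsHS.mul_left (h : IsHS b T) (C : H →L[ℂ] H) : IsHS b (C * T) :=
  .of_le (h.summable.mul_left (‖C‖ ^ 2)) fun _ => norm_mul_apply_sq_le C _

theorem IsHS.hsSq_mul_left_le (h : IsHS b T) (C : H →L[ℂ] H) :
    hsSq b (C * T) ≤ ‖C‖ ^ 2 * hsSq b T := by
  unfold hsSq
  rw [← tsum_mul_left]
  exact (h.mul_left C).tsum_le_tsum (fun _ => norm_mul_apply_sq_le C _) (h.summable.mul_left _)

protected theorem IsHS.mul_right (h : IsHS b T) (C : H →L[ℂ] H) : IsHS b (T * C) := by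
  simpa using (h.star.mul_left (Star.star C)).star

theorem IsHS.hsSq_mul_right_le (h : IsHS b T) (C : H →L[ℂ] H) :
    hsSq b (T * C) ≤ ‖C‖ ^ 2 * hsSq b T := by
  rw [← (h.mul_right C).hsSq_star, star_mul, ← h.hsSq_star, ← norm_star C]
  exact h.star.hsSq_mul_left_le _

protected theorem IsHS.add (hS : IsHS b S) (hT : IsHS b T) : IsHS b (S + T) := by
  refine .of_le ((hS.summable.mul_left 2).add (hT.summable.mul_left 2)) fun i => ?_
  have h := norm_add_le (S (b i)) (T (b i))
  have h2 := pow_le_pow_left₀ (norm_nonneg _) h 2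
  simp only [add_apply]
  nlinarith [sq_nonneg (‖S (b i)‖ - ‖T (b i)‖)]

protected theorem IsHS.neg (hT : IsHS b T) : IsHS b (-T) := by
  simpa [IsHS] using hT

theorem IsHS.norm_apply_sq_le (h : IsHS b T) (x : H) : ‖T x‖ ^ 2 ≤ hsSq b T * ‖x‖ ^ 2 := by
  rw [← (hasSum_norm_inner_sq b (T x)).tsum_eq, ← h.hsSq_star, hsSq, ← tsum_mul_right]
  refine (hasSum_norm_inner_sq b (T x)).summable.tsum_le_tsum (fun i => ?_) (h.star.summable.mul_right _)
  rw [← norm_inner_star, norm_inner_symm, ← mul_pow]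
  gcongr
  exact norm_inner_le_norm _ _

theorem norm_inner_le_half_add (x y : H) : ‖⟪x, y⟫_ℂ‖ ≤ (‖x‖ ^ 2 + ‖y‖ ^ 2) / 2 := by
  have := norm_inner_le_norm (𝕜 := ℂ) x y
  nlinarith [sq_nonneg (‖x‖ - ‖y‖)]

theorem IsHS.summable_inner (hS : IsHS b S) (hT : IsHS b T) :
    Summable fun i => ⟪S (b i), T (b i)⟫_ℂ :=
  .of_norm_bounded ((hS.summable.add hT.summable).div_const 2) fun _ => norm_inner_le_half_add _ _

/-- This is `tr(S* T) = tr(T S*)`, by exchanging an absolutely convergent double sum of matrix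
entries. Every later use of cyclicity rests on it. -/
theorem IsHS.tsum_inner_star (hS : IsHS b S) (hT : IsHS b T) :
    ∑' i, ⟪S (b i), T (b i)⟫_ℂ = ∑' i, ⟪star T (b i), star S (b i)⟫_ℂ := by
  have h : Summable (Function.uncurry fun i j => ⟪S (b i), b j⟫_ℂ * ⟪b j, T (b i)⟫_ℂ) := by
    refine .of_norm_bounded ((hS.summable_prod.add hT.summable_prod).div_const 2) fun p => ?_
    simp only [Function.uncurry, norm_mul]
    rw [norm_inner_symm]
    nlinarith [sq_nonneg (‖⟪b p.2, S (b p.1)⟫_ℂ‖ - ‖⟪b p.2, T (b p.1)⟫_ℂ‖)]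
  have h2 := h.tsum_comm
  simp only [b.tsum_inner_mul_inner] at h2
  rw [← h2]
  refine tsum_congr fun j => ?_
  rw [← b.tsum_inner_mul_inner]
  refine tsum_congr fun i => ?_
  rw [ContinuousLinearMap.star_eq_adjoint, ContinuousLinearMap.star_eq_adjoint,
    ContinuousLinearMap.adjoint_inner_left, ContinuousLinearMap.adjoint_inner_right, mul_comm]

end HilbertSchmidt

/-! ### Self-adjoint trace class operators as differences of positive ones -/

section Nuclear

set_option linter.unusedSectionVars false

variable {ι : Type*} {b : HilbertBasis ι ℂ H} {S T G K : H →L[ℂ] H}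

theorem inner_selfAdjoint_apply_left (hK : IsSelfAdjoint K) (x y : H) :
    ⟪K x, y⟫_ℂ = ⟪x, K y⟫_ℂ :=
  ContinuousLinearMap.isSelfAdjoint_iff_isSymmetric.1 hK x y

theorem inner_star_apply (A : H →L[ℂ] H) (x y : H) : ⟪star A x, y⟫_ℂ = ⟪x, A y⟫_ℂ := by
  rw [ContinuousLinearMap.star_eq_adjoint, ContinuousLinearMap.adjoint_inner_left]

theorem re_inner_selfAdjoint_mul_self (hK : IsSelfAdjoint K) (x : H) :
    RCLike.re ⟪x, (K * K) x⟫_ℂ = ‖K x‖ ^ 2 := by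
  rw [mul_apply_eq_comp, ← inner_selfAdjoint_apply_left hK,
    inner_self_eq_norm_sq (𝕜 := ℂ)]

theorem re_inner_nonneg_of_nonneg (hG : 0 ≤ G) (x : H) : 0 ≤ RCLike.re ⟪x, G x⟫_ℂ :=
  ((ContinuousLinearMap.nonneg_iff_isPositive _).1 hG).re_inner_nonneg_right x

theorem re_inner_le_of_le (h : S ≤ T) (x : H) :
    RCLike.re ⟪x, S x⟫_ℂ ≤ RCLike.re ⟪x, T x⟫_ℂ := by
  have := re_inner_nonneg_of_nonneg (sub_nonneg.2 h) x
  rw [sub_apply, inner_sub_right, map_sub] at this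
  linarith

/-- `G` is a positive operator with finite trace. -/
structure IsPosTrace (b : HilbertBasis ι ℂ H) (G : H →L[ℂ] H) : Prop where
  nonneg : 0 ≤ G
  summable : Summable fun i => RCLike.re ⟪b i, G (b i)⟫_ℂ

theorem IsPosTrace.exists_sqrt (h : IsPosTrace b G) :
    ∃ K, IsSelfAdjoint K ∧ IsHS b K ∧ G = K * K := by
  have hs : IsSelfAdjoint (CFC.sqrt G) := (CFC.sqrt_nonneg G).isSelfAdjoint
  have hm := CFC.sqrt_mul_sqrt_self G h.nonneg
  refine ⟨CFC.sqrt G, hs, ?_, hm.symm⟩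
  have := h.summable
  rw [← hm] at this
  simp only [re_inner_selfAdjoint_mul_self hs] at this
  exact this

theorem IsPosTrace.of_le (h : IsPosTrace b G) (hS : 0 ≤ S) (hSG : S ≤ G) : IsPosTrace b S :=
  ⟨hS, .of_nonneg_of_le (fun _ => re_inner_nonneg_of_nonneg hS _)
    (fun _ => re_inner_le_of_le hSG _) h.summable⟩

theorem IsPosTrace.add (hS : IsPosTrace b S) (hT : IsPosTrace b T) : IsPosTrace b (S + T) :=
  ⟨add_nonneg hS.nonneg hT.nonneg, by
    simpa [inner_add_right] using hS.summable.add hT.summable⟩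

theorem IsPosTrace.smul (hT : IsPosTrace b T) {c : ℝ} (hc : 0 ≤ c) : IsPosTrace b (c • T) :=
  ⟨smul_nonneg hc hT.nonneg, by
    simpa [inner_smul_right_eq_smul] using hT.summable.mul_left c⟩

/-- `T` is a difference of positive operators with finite trace. -/
def IsNuclear (b : HilbertBasis ι ℂ H) (T : H →L[ℂ] H) : Prop :=
  ∃ G G', IsPosTrace b G ∧ IsPosTrace b G' ∧ T = G - G'

theorem IsNuclear.add (hS : IsNuclear b S) (hT : IsNuclear b T) : IsNuclear b (S + T) := by
  obtain ⟨G, G', hG, hG', rfl⟩ := hS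
  obtain ⟨F, F', hF, hF', rfl⟩ := hT
  exact ⟨G + F, G' + F', hG.add hF, hG'.add hF', by abel⟩

theorem IsNuclear.neg (hT : IsNuclear b T) : IsNuclear b (-T) := by
  obtain ⟨F, F', hF, hF', rfl⟩ := hT
  exact ⟨F', F, hF', hF, by abel⟩

theorem IsNuclear.sub (hS : IsNuclear b S) (hT : IsNuclear b T) : IsNuclear b (S - T) := by
  rw [sub_eq_add_neg]
  exact hS.add hT.neg

theorem IsNuclear.smul (hT : IsNuclear b T) {c : ℝ} (hc : 0 ≤ c) : IsNuclear b (c • T) := by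
  obtain ⟨F, F', hF, hF', rfl⟩ := hT
  exact ⟨c • F, c • F', hF.smul hc, hF'.smul hc, smul_sub _ _ _⟩

theorem IsNuclear.isPosTrace (hT : IsNuclear b T) (h : 0 ≤ T) : IsPosTrace b T := by
  obtain ⟨F, F', hF, hF', rfl⟩ := hT
  exact hF.of_le h (sub_le_self _ hF'.nonneg)

theorem IsNuclear.exists_sqrt (hT : IsNuclear b T) :
    ∃ K L, IsSelfAdjoint K ∧ IsSelfAdjoint L ∧ IsHS b K ∧ IsHS b L ∧ T = K * K - L * L := by
  obtain ⟨F, F', hF, hF', rfl⟩ := hT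
  obtain ⟨K, h1, h2, rfl⟩ := hF.exists_sqrt
  obtain ⟨L, h3, h4, rfl⟩ := hF'.exists_sqrt
  exact ⟨K, L, h1, h3, h2, h4, rfl⟩

theorem IsNuclear.isSelfAdjoint (hT : IsNuclear b T) : IsSelfAdjoint T := by
  obtain ⟨F, F', hF, hF', rfl⟩ := hT
  exact hF.nonneg.isSelfAdjoint.sub hF'.nonneg.isSelfAdjoint

theorem IsNuclear.isHS (hT : IsNuclear b T) : IsHS b T := by
  obtain ⟨K, L, -, -, hK, hL, rfl⟩ := hT.exists_sqrt
  rw [sub_eq_add_neg]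
  exact (hK.mul_left K).add (hL.mul_left L).neg

/-- The sum of the diagonal matrix entries. -/
def diagSum (b : HilbertBasis ι ℂ H) (T : H →L[ℂ] H) : ℂ :=
  ∑' i, ⟪b i, T (b i)⟫_ℂ

/-- Giving one factor `K` to each side of the inner product makes the sum a pairing of the
Hilbert–Schmidt operators `K A*` and `K C`, to which cyclicity applies. -/
theorem hasSum_inner_mul_sq_mul (hK : IsSelfAdjoint K) (h : IsHS b K) (A C : H →L[ℂ] H) :
    HasSum (fun i => ⟪b i, (A * (K * K) * C) (b i)⟫_ℂ) (∑' i, ⟪K (b i), (C * A) (K (b i))⟫_ℂ) := by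
  have e (i) : ⟪b i, (A * (K * K) * C) (b i)⟫_ℂ = ⟪(K * star A) (b i), (K * C) (b i)⟫_ℂ := by
    simp only [mul_apply_eq_comp]
    rw [inner_selfAdjoint_apply_left hK, inner_star_apply]
  have e' (i) : ⟪K (b i), (C * A) (K (b i))⟫_ℂ =
      ⟪star (K * C) (b i), star (K * star A) (b i)⟫_ℂ := by
    simp only [star_mul, star_star, hK.star_eq, mul_apply_eq_comp]
    rw [inner_star_apply]
  have hA := h.mul_right (star A)
  have hC := h.mul_right C
  simp only [e, e']
  rw [← hA.tsum_inner_star hC]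
  exact (hA.summable_inner hC).hasSum

/-- Cyclicity `tr(A T C) = tr(T C A)`. The convergence is part of the claim, so `diagSum` is never
the default value of a divergent sum here. -/
theorem IsNuclear.hasSum_inner_mul_mul (hT : IsNuclear b T) (A C : H →L[ℂ] H) :
    HasSum (fun i => ⟪b i, (A * T * C) (b i)⟫_ℂ) (diagSum b (T * (C * A))) := by
  obtain ⟨K, L, hK, hL, hK', hL', rfl⟩ := hT.exists_sqrt
  have h (A C : H →L[ℂ] H) := (hasSum_inner_mul_sq_mul hK hK' A C).sub
    (hasSum_inner_mul_sq_mul hL hL' A C)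
  have e (A C : H →L[ℂ] H) (i) : ⟪b i, (A * (K * K) * C) (b i)⟫_ℂ -
      ⟪b i, (A * (L * L) * C) (b i)⟫_ℂ = ⟪b i, (A * (K * K - L * L) * C) (b i)⟫_ℂ := by
    rw [← inner_sub_right, ← sub_apply, mul_sub, sub_mul]
  simp only [e] at h
  have h1 := (h 1 (C * A)).tsum_eq
  simp only [one_mul, mul_one] at h1
  rw [diagSum, h1]
  exact h A C

theorem IsNuclear.hasSum_inner_mul (hT : IsNuclear b T) (C : H →L[ℂ] H) :
    HasSum (fun i => ⟪b i, (T * C) (b i)⟫_ℂ) (diagSum b (T * C)) := by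
  simpa using hT.hasSum_inner_mul_mul 1 C

theorem IsNuclear.diagSum_add_mul (hS : IsNuclear b S) (hT : IsNuclear b T) (C : H →L[ℂ] H) :
    diagSum b ((S + T) * C) = diagSum b (S * C) + diagSum b (T * C) := by
  rw [← ((hS.hasSum_inner_mul C).add (hT.hasSum_inner_mul C)).tsum_eq, diagSum]
  simp [add_mul]

theorem diagSum_neg : diagSum b (-T) = -diagSum b T := by
  simp [diagSum, tsum_neg]

theorem diagSum_smul (c : ℝ) : diagSum b (c • T) = c * diagSum b T := by
  simp [diagSum, inner_smul_right_eq_smul, tsum_mul_left]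

theorem IsNuclear.diagSum_mul_sub (hT : IsNuclear b T) (C D : H →L[ℂ] H) :
    diagSum b (T * (C - D)) = diagSum b (T * C) - diagSum b (T * D) := by
  rw [← ((hT.hasSum_inner_mul C).sub (hT.hasSum_inner_mul D)).tsum_eq, diagSum]
  simp [mul_sub]

theorem IsNuclear.diagSum_mul_sum (hT : IsNuclear b T) {κ : Type*} (s : Finset κ)
    (C : κ → H →L[ℂ] H) :
    diagSum b (T * ∑ k ∈ s, C k) = ∑ k ∈ s, diagSum b (T * C k) := by
  rw [← (hasSum_sum fun k (_ : k ∈ s) => hT.hasSum_inner_mul (C k)).tsum_eq, diagSum]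
  simp [Finset.mul_sum]

theorem IsNuclear.conj_diagSum_mul (hT : IsNuclear b T) (C : H →L[ℂ] H) :
    (starRingEnd ℂ) (diagSum b (T * C)) = diagSum b (T * star C) := by
  have h := hT.hasSum_inner_mul_mul (star C) 1
  rw [one_mul] at h
  rw [← h.tsum_eq, diagSum, Complex.conj_tsum]
  refine tsum_congr fun i => ?_
  rw [inner_conj_symm, mul_one, ← inner_star_apply, star_mul, star_star,
    hT.isSelfAdjoint.star_eq]

theorem IsNuclear.re_diagSum_mul_nonneg (hT : IsNuclear b T) (h : 0 ≤ T) {C : H →L[ℂ] H}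
    (hC : 0 ≤ C) : 0 ≤ (diagSum b (T * C)).re := by
  obtain ⟨K, hK, hK', rfl⟩ := (hT.isPosTrace h).exists_sqrt
  have h := hasSum_inner_mul_sq_mul hK hK' 1 C
  simp only [one_mul, mul_one] at h
  rw [diagSum, h.tsum_eq]
  have hs : Summable fun i => ⟪K (b i), C (K (b i))⟫_ℂ := by
    have := hK'.summable_inner (hK'.mul_left C)
    simpa only [mul_apply_eq_comp] using this
  rw [Complex.re_tsum hs]
  exact tsum_nonneg fun i => re_inner_nonneg_of_nonneg hC _

theorem tendsto_diagSum_sq_mul (h : IsHS b K) {C : ℕ → H →L[ℂ] H}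
    {D : H →L[ℂ] H} {M : ℝ} (hM : ∀ n, ‖C n‖ ≤ M)
    (hC : ∀ x, Tendsto (fun n => C n x) atTop (𝓝 (D x))) :
    Tendsto (fun n => ∑' i, ⟪K (b i), (C n) (K (b i))⟫_ℂ) atTop
      (𝓝 (∑' i, ⟪K (b i), D (K (b i))⟫_ℂ)) := by
  refine tendsto_tsum_of_dominated_convergence (h.summable.mul_left M)
    (fun i => tendsto_const_nhds.inner (hC _)) (.of_forall fun n i => ?_)
  refine (norm_inner_le_norm _ _).trans ?_
  calc ‖K (b i)‖ * ‖C n (K (b i))‖ ≤ ‖K (b i)‖ * (M * ‖K (b i)‖) := by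
        gcongr
        exact (C n).le_of_opNorm_le (hM n) _
    _ = M * ‖K (b i)‖ ^ 2 := by ring

/-- Dominated convergence with majorant `M ‖K b i‖ ^ 2`. Strong convergence suffices, which matters
because partial sums of spectral projections need not converge in norm. -/
theorem IsNuclear.tendsto_diagSum_mul (hT : IsNuclear b T) {C : ℕ → H →L[ℂ] H}
    {D : H →L[ℂ] H} {M : ℝ} (hM : ∀ n, ‖C n‖ ≤ M)
    (hC : ∀ x, Tendsto (fun n => C n x) atTop (𝓝 (D x))) :
    Tendsto (fun n => diagSum b (T * C n)) atTop (𝓝 (diagSum b (T * D))) := by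
  obtain ⟨K, L, hK, hL, hK', hL', rfl⟩ := hT.exists_sqrt
  have e (C : H →L[ℂ] H) := ((hasSum_inner_mul_sq_mul hK hK' 1 C).sub
    (hasSum_inner_mul_sq_mul hL hL' 1 C)).tsum_eq
  simp only [one_mul, mul_one, ← inner_sub_right, ← sub_apply,
    ← sub_mul] at e
  simp only [diagSum, e]
  exact (tendsto_diagSum_sq_mul hK' hM hC).sub (tendsto_diagSum_sq_mul hL' hM hC)

/-! ### Trace class operators -/

theorem summable_of_isTraceClass (h : IsTraceClass T) :
    Summable fun i => RCLike.re ⟪stdBasis H i, CFC.abs T (stdBasis H i)⟫_ℂ := by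
  have := ENNReal.summable_toReal h.ne
  simpa only [ENNReal.toReal_ofReal (re_inner_nonneg_of_nonneg (CFC.abs_nonneg T) _)] using this

theorem isPosTrace_abs (h : IsTraceClass T) : IsPosTrace (stdBasis H) (CFC.abs T) :=
  ⟨CFC.abs_nonneg T, summable_of_isTraceClass h⟩

theorem isNuclear_of_isTraceClass (hT : IsSelfAdjoint T) (h : IsTraceClass T) :
    IsNuclear (stdBasis H) T := by
  have h1 := CFC.posPart_add_negPart T hT
  have hp := CFC.posPart_nonneg T
  have hn := CFC.negPart_nonneg T
  refine ⟨T⁺, T⁻, (isPosTrace_abs h).of_le hp ?_, (isPosTrace_abs h).of_le hn ?_,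
    (CFC.posPart_sub_negPart T hT).symm⟩
  · rw [← h1]
    exact le_add_of_nonneg_right hn
  · rw [← h1]
    exact le_add_of_nonneg_left hp

/-- If `|T| = K * K`, the trace norm is the squared Hilbert–Schmidt norm of `K`, which dominates
`‖K‖ ^ 2`. -/
theorem ofReal_norm_le_traceNorm (T : H →L[ℂ] H) : ENNReal.ofReal ‖T‖ ≤ traceNorm T := by
  by_cases h : traceNorm T = ∞
  · simp [h]
  have hT : IsTraceClass T := lt_top_iff_ne_top.2 h
  obtain ⟨K, hK, hK', hM⟩ := (isPosTrace_abs hT).exists_sqrt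
  have hn : traceNorm T = ENNReal.ofReal (hsSq (stdBasis H) K) := by
    rw [hsSq, ENNReal.ofReal_tsum_of_nonneg (fun _ => by positivity) hK']
    simp only [traceNorm, hM, re_inner_selfAdjoint_mul_self hK]
  rw [hn]
  refine ENNReal.ofReal_le_ofReal ?_
  rw [← CFC.norm_abs, hM]
  have hK2 : ‖K‖ ≤ √(hsSq (stdBasis H) K) := by
    refine K.opNorm_le_bound (Real.sqrt_nonneg _) fun x => ?_
    refine abs_le_of_sq_le_sq' ?_ (by positivity) |>.2
    rw [mul_pow, Real.sq_sqrt hsSq_nonneg]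
    exact hK'.norm_apply_sq_le x
  calc ‖K * K‖ ≤ ‖K‖ * ‖K‖ := norm_mul_le _ _
    _ ≤ √(hsSq (stdBasis H) K) * √(hsSq (stdBasis H) K) := by gcongr
    _ = _ := Real.mul_self_sqrt hsSq_nonneg

/-- An approximate polar decomposition. -/
theorem exists_contraction_norm_abs_sub_le (A : H →L[ℂ] H) {ε : ℝ} (hε : 0 < ε) :
    ∃ U : H →L[ℂ] H, ‖U‖ ≤ 1 ∧ ‖CFC.abs A - star U * A‖ ≤ ε := by
  have hM : 0 ≤ CFC.abs A := CFC.abs_nonneg A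
  have hMM := CFC.abs_mul_abs A
  set M := CFC.abs A
  have hMs : IsSelfAdjoint M := hM.isSelfAdjoint
  have hsp : ∀ t ∈ spectrum ℝ M, 0 ≤ t := fun t ht => spectrum_nonneg_of_nonneg hM ht
  have hc : ContinuousOn (fun t : ℝ => (t + ε)⁻¹) (spectrum ℝ M) := by
    refine ContinuousOn.inv₀ (by fun_prop) fun t ht => ?_
    have := hsp t ht
    positivity
  have hg : ContinuousOn (fun t : ℝ => (t + ε)⁻¹ * (t * t)) (spectrum ℝ M) :=
    hc.mul (by fun_prop)
  set Z := cfc (fun t : ℝ => (t + ε)⁻¹) M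
  have hZ : IsSelfAdjoint Z := cfc_predicate _ _
  have hid : cfc (fun t : ℝ => t) M = M := cfc_id' ℝ M
  have hZMM : Z * (M * M) = cfc (fun t : ℝ => (t + ε)⁻¹ * (t * t)) M := by
    rw [cfc_mul _ _ M hc (by fun_prop), cfc_mul _ _ M (by fun_prop) (by fun_prop), hid]
  -- With `U = A (|A| + ε)⁻¹`, both `U* U = (|A| / (|A| + ε))²` and `|A| - U* A = ε |A| / (|A| + ε)`
  -- are functions of `|A|`, with bounds `1` and `ε` on its spectrum.
  refine ⟨A * Z, ?_, ?_⟩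
  · have h1 : ‖A * Z‖ * ‖A * Z‖ ≤ 1 := by
      rw [← CStarRing.norm_star_mul_self, star_mul, hZ.star_eq]
      have : Z * star A * (A * Z) = cfc (fun t : ℝ => (t + ε)⁻¹ * (t * t) * (t + ε)⁻¹) M := by
        rw [cfc_mul _ _ M hg hc, ← hZMM, hMM]
        simp only [mul_assoc, Z]
      rw [this]
      refine norm_cfc_le zero_le_one fun t ht => ?_
      have := hsp t ht
      have h2 : (t + ε)⁻¹ * (t * t) * (t + ε)⁻¹ = (t / (t + ε)) ^ 2 := by
        field_simp
      rw [h2, norm_pow, Real.norm_of_nonneg (by positivity)]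
      refine pow_le_one₀ (by positivity) ?_
      rw [div_le_one (by positivity)]
      linarith
    nlinarith [norm_nonneg (A * Z)]
  · rw [star_mul, hZ.star_eq, mul_assoc, ← hMM, hZMM]
    nth_rw 1 [← hid]
    rw [← cfc_sub (fun t : ℝ => t) _ M (by fun_prop) hg]
    refine norm_cfc_le hε.le fun t ht => ?_
    have := hsp t ht
    have h2 : t - (t + ε)⁻¹ * (t * t) = ε * (t / (t + ε)) := by
      field_simp
      ring
    rw [h2, Real.norm_of_nonneg (by positivity)]
    refine mul_le_of_le_one_right hε.le ?_
    rw [div_le_one (by positivity)]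
    linarith

/-- Replacing `|T P|` by `U* T P` turns its diagonal entries into pairings of `K U` with `K P` and
of `L U` with `L P`, which are summable with a bound independent of `U`. -/
theorem IsNuclear.isTraceClass_mul (hT : IsNuclear (stdBasis H) T) (P : H →L[ℂ] H) :
    IsTraceClass (T * P) := by
  obtain ⟨K, L, hK, hL, hK', hL', rfl⟩ := hT.exists_sqrt
  set T := K * K - L * L
  set e := stdBasis H
  have key (J : Finset (basisIndex H)) : ∑ i ∈ J, RCLike.re ⟪e i, CFC.abs (T * P) (e i)⟫_ℂ ≤
      (1 + ‖P‖ ^ 2) * (hsSq e K + hsSq e L) / 2 := by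
    refine le_of_forall_pos_le_add fun δ hδ => ?_
    -- The error per entry is chosen so that the entries in `J` together contribute at most `δ`.
    obtain ⟨U, hU, hU'⟩ := exists_contraction_norm_abs_sub_le (T * P)
      (ε := δ / (J.card + 1)) (by positivity)
    have one (K : H →L[ℂ] H) (hK' : IsHS e K) :
        ∑ i ∈ J, (‖(K * U) (e i)‖ ^ 2 + ‖(K * P) (e i)‖ ^ 2) ≤ (1 + ‖P‖ ^ 2) * hsSq e K := by
      rw [Finset.sum_add_distrib]
      have h1 := (hK'.mul_right U).summable.sum_le_tsum J fun _ _ => by positivity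
      have h2 := (hK'.mul_right P).summable.sum_le_tsum J fun _ _ => by positivity
      have h3 := hK'.hsSq_mul_right_le U
      have h4 := hK'.hsSq_mul_right_le P
      have h5 : ‖U‖ ^ 2 * hsSq e K ≤ 1 * hsSq e K := by
        gcongr
        · exact hsSq_nonneg
        · exact pow_le_one₀ (norm_nonneg _) hU
      rw [← hsSq] at h1 h2
      linarith
    have term (i) : RCLike.re ⟪e i, CFC.abs (T * P) (e i)⟫_ℂ ≤ δ / (J.card + 1) +
        (‖(K * U) (e i)‖ ^ 2 + ‖(K * P) (e i)‖ ^ 2) / 2 +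
        (‖(L * U) (e i)‖ ^ 2 + ‖(L * P) (e i)‖ ^ 2) / 2 := by
      have h1 : CFC.abs (T * P) (e i) =
          (CFC.abs (T * P) - star U * (T * P)) (e i) + (star U * (T * P)) (e i) := by
        simp
      have h2 : ⟪e i, (star U * (T * P)) (e i)⟫_ℂ =
          ⟪(K * U) (e i), (K * P) (e i)⟫_ℂ - ⟪(L * U) (e i), (L * P) (e i)⟫_ℂ := by
        simp only [T, mul_apply_eq_comp]
        rw [← inner_star_apply, star_star, sub_apply, inner_sub_right]
        simp only [mul_apply_eq_comp]
        rw [inner_selfAdjoint_apply_left hK, inner_selfAdjoint_apply_left hL]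
      have h3 : ‖⟪e i, (CFC.abs (T * P) - star U * (T * P)) (e i)⟫_ℂ‖ ≤ δ / (J.card + 1) := by
        refine (norm_inner_le_norm _ _).trans ?_
        have := (ContinuousLinearMap.le_of_opNorm_le _ hU' (e i))
        rw [e.orthonormal.1 i] at this ⊢
        linarith
      rw [h1, inner_add_right, h2, map_add, map_sub]
      have a1 := (RCLike.re_le_norm _).trans h3
      have a2 := (RCLike.re_le_norm _).trans
        (norm_inner_le_half_add ((K * U) (e i)) ((K * P) (e i)))
      have a3 := (RCLike.re_le_norm _).trans
        (norm_inner_le_half_add (-(L * U) (e i)) ((L * P) (e i)))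
      rw [inner_neg_left, map_neg, norm_neg] at a3
      linarith
    refine (Finset.sum_le_sum fun i _ => term i).trans ?_
    rw [Finset.sum_add_distrib, Finset.sum_add_distrib, Finset.sum_const, nsmul_eq_mul]
    simp only [← Finset.sum_div _ _ (2 : ℝ)]
    have h1 := one K hK'
    have h2 := one L hL'
    have h3 : (J.card : ℝ) * (δ / (J.card + 1)) ≤ δ := by
      rw [mul_div_assoc', div_le_iff₀ (by positivity)]
      nlinarith
    linarith
  have hs := summable_of_sum_le
    (fun i => re_inner_nonneg_of_nonneg (CFC.abs_nonneg (T * P)) (e i)) key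
  rw [IsTraceClass, traceNorm, ← ENNReal.ofReal_tsum_of_nonneg
    (fun i => re_inner_nonneg_of_nonneg (CFC.abs_nonneg (T * P)) (e i)) hs]
  exact ENNReal.ofReal_lt_top

end Nuclear

/-! ### Projection-valued measures -/

namespace ProjectionValuedMeasure

variable (E : ProjectionValuedMeasure H) {B C : Set ℝ} {x y : H}

theorem isSelfAdjoint_proj (hB : MeasurableSet B) : IsSelfAdjoint (E.proj B) :=
  (E.isStarProjection B hB).isSelfAdjoint

theorem proj_mul_self (hB : MeasurableSet B) : E.proj B * E.proj B = E.proj B :=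
  (E.isStarProjection B hB).isIdempotentElem

theorem norm_proj_le (hB : MeasurableSet B) : ‖E.proj B‖ ≤ 1 :=
  IsStarProjection.norm_le _ (E.isStarProjection B hB)

theorem norm_proj_apply_le (hB : MeasurableSet B) (x : H) : ‖E.proj B x‖ ≤ ‖x‖ := by
  simpa using (E.proj B).le_of_opNorm_le (E.norm_proj_le hB) x

theorem proj_union (hB : MeasurableSet B) (hC : MeasurableSet C) (h : Disjoint B C) :
    E.proj (B ∪ C) = E.proj B + E.proj C := by
  ext x
  let S : ℕ → Set ℝ := fun n => if n = 0 then B else if n = 1 then C else ∅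
  have hS : ∀ n, MeasurableSet (S n) := fun n => by
    dsimp only [S]
    split_ifs <;> simp [hB, hC]
  have hd : Pairwise (Function.onFun Disjoint S) := by
    intro m n hmn
    simp only [Function.onFun, S]
    split_ifs <;> simp_all [disjoint_comm]
  have hU : ⋃ n, S n = B ∪ C := by
    ext t
    simp only [mem_iUnion, mem_union, S]
    constructor
    · rintro ⟨n, hn⟩
      split_ifs at hn <;> simp_all
    · rintro (h | h)
      · exact ⟨0, by simpa using h⟩
      · exact ⟨1, by simpa using h⟩
  have h1 := E.hasSum_iUnion S hS hd x
  rw [hU] at h1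
  have h2 := hasSum_sum_of_ne_finset_zero (f := fun n => E.proj (S n) x) (s := {0, 1})
    (L := .unconditional ℕ)
    fun n hn => by
      have : S n = ∅ := by
        simp only [Finset.mem_insert, Finset.mem_singleton, not_or] at hn
        simp [S, hn.1, hn.2]
      rw [this, E.proj_empty]
  rw [h1.unique h2]
  simp [S]

theorem proj_empty_eq_zero : E.proj ∅ = 0 := by
  ext x
  exact E.proj_empty x

theorem proj_biUnion_finset {S : ℕ → Set ℝ} (hS : ∀ n, MeasurableSet (S n))
    (hd : Pairwise (Function.onFun Disjoint S)) (s : Finset ℕ) :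
    E.proj (⋃ n ∈ s, S n) = ∑ n ∈ s, E.proj (S n) := by
  induction s using Finset.induction_on with
  | empty => simp [proj_empty_eq_zero]
  | insert n s hn ih =>
    rw [Finset.set_biUnion_insert, Finset.sum_insert hn, ← ih]
    refine E.proj_union (hS n) (s.measurableSet_biUnion fun m _ => hS m) ?_
    simp only [disjoint_iUnion_right]
    intro m hm
    exact hd fun h => hn (h ▸ hm)

/-- The sum of the two idempotents is again idempotent, so they anticommute, and anticommuting
idempotents have product zero. -/
theorem proj_mul_eq_zero (hB : MeasurableSet B) (hC : MeasurableSet C) (h : Disjoint B C) :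
    E.proj B * E.proj C = 0 := by
  have hU := (E.isStarProjection _ (hB.union hC)).isIdempotentElem
  rw [E.proj_union hB hC h] at hU
  have hBi := (E.isStarProjection _ hB).isIdempotentElem
  have : IsAddTorsionFree (H →L[ℂ] H) := .of_isTorsionFree ℂ _
  exact hBi.mul_eq_zero_of_anticommute
    ((hBi.add_iff (E.isStarProjection _ hC).isIdempotentElem).1 hU)

theorem proj_mul (hB : MeasurableSet B) (hC : MeasurableSet C) :
    E.proj B * E.proj C = E.proj (B ∩ C) := by
  have h1 := E.proj_union (hB.inter hC) (hB.diff hC) disjoint_inf_sdiff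
  have h2 := E.proj_union (hC.inter hB) (hC.diff hB) disjoint_inf_sdiff
  rw [inter_union_sdiff] at h1 h2
  rw [inter_comm C B] at h2
  rw [h1, h2, add_mul, mul_add, mul_add, E.proj_mul_self (hB.inter hC),
    E.proj_mul_eq_zero (hB.inter hC) (hC.diff hB), E.proj_mul_eq_zero (hB.diff hC) (hB.inter hC),
    E.proj_mul_eq_zero (hB.diff hC) (hC.diff hB)]
  · simp
  · exact disjoint_sdiff_left.mono_right sdiff_subset
  · exact disjoint_sdiff_left.mono_right inter_subset_right
  · exact disjoint_sdiff_right.mono_left inter_subset_left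

theorem proj_compl (hB : MeasurableSet B) : E.proj Bᶜ = 1 - E.proj B := by
  have := E.proj_union hB hB.compl disjoint_compl_right
  rw [union_compl_self, E.proj_univ] at this
  rw [this, add_sub_cancel_left]

theorem measure_apply (x : H) (hB : MeasurableSet B) :
    E.measure x B = ENNReal.ofReal (RCLike.re ⟪x, E.proj B x⟫_ℂ) :=
  Measure.ofMeasurable_apply B hB

theorem measure_univ (x : H) : E.measure x univ = ENNReal.ofReal (‖x‖ ^ 2) := by
  rw [E.measure_apply x .univ, E.proj_univ, one_apply_eq_self,
    inner_self_eq_norm_sq (𝕜 := ℂ)]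

instance isFiniteMeasure_measure (x : H) : IsFiniteMeasure (E.measure x) :=
  ⟨by rw [E.measure_univ]; exact ENNReal.ofReal_lt_top⟩

theorem real_measure_univ (x : H) : (E.measure x).real univ = ‖x‖ ^ 2 := by
  rw [Measure.real, E.measure_univ, ENNReal.toReal_ofReal (by positivity)]

theorem measure_proj (x : H) (hC : MeasurableSet C) :
    E.measure (E.proj C x) = (E.measure x).restrict C := by
  ext B hB
  rw [Measure.restrict_apply hB, E.measure_apply _ hB, E.measure_apply _ (hB.inter hC),
    inner_selfAdjoint_apply_left (E.isSelfAdjoint_proj hC)]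
  simp only [← mul_apply_eq_comp]
  rw [E.proj_mul hB hC, E.proj_mul hC (hB.inter hC),
    inter_eq_self_of_subset_right inter_subset_right]

theorem inner_proj_eq_zero (hB : MeasurableSet B) (hC : MeasurableSet C)
    (hx : E.proj C x = x) (hy : E.proj C y = 0) : ⟪x, E.proj B y⟫_ℂ = 0 := by
  rw [← hx, inner_selfAdjoint_apply_left (E.isSelfAdjoint_proj hC), ← mul_apply_eq_comp,
    E.proj_mul hC hB, inter_comm, ← E.proj_mul hB hC, mul_apply_eq_comp, hy]
  simp

theorem measure_add (hC : MeasurableSet C) (hx : E.proj C x = x) (hy : E.proj C y = 0) :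
    E.measure (x + y) = E.measure x + E.measure y := by
  ext B hB
  rw [Measure.add_apply, E.measure_apply _ hB, E.measure_apply _ hB, E.measure_apply _ hB,
    ← ENNReal.ofReal_add (E.inner_nonneg x hB) (E.inner_nonneg y hB)]
  have h1 := E.inner_proj_eq_zero hB hC hx hy
  have h2 : ⟪y, E.proj B x⟫_ℂ = 0 := by
    rw [← inner_selfAdjoint_apply_left (E.isSelfAdjoint_proj hB), ← inner_conj_symm, h1, map_zero]
  rw [map_add, inner_add_right, inner_add_left, inner_add_left, h1, h2]
  simp

theorem ae_mem (hC : MeasurableSet C) (hx : E.proj C x = x) : ∀ᵐ l ∂E.measure x, l ∈ C := by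
  rw [← hx, E.measure_proj x hC]
  exact ae_restrict_mem hC

/-! ### Reduction of `A` by its spectral subspaces, from the quadratic form alone -/

namespace IsSpectralMeasureOf

variable {E} {A : H →ₗ.[ℂ] H}

theorem integrable_sq (h : E.IsSpectralMeasureOf A) (x : A.domain) :
    Integrable (fun l : ℝ => l ^ 2) (E.measure (x : H)) :=
  (h.mem_domain_iff _).1 x.2

theorem integrable_id (h : E.IsSpectralMeasureOf A) (x : A.domain) :
    Integrable (fun l : ℝ => l) (E.measure (x : H)) := by
  refine ((h.integrable_sq x).add (integrable_const (1 : ℝ))).mono'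
    measurable_id.aestronglyMeasurable (.of_forall fun l => ?_)
  rw [Real.norm_eq_abs, Pi.add_apply]
  nlinarith [sq_abs l, sq_nonneg (|l| - 1)]

theorem proj_mem_domain (h : E.IsSpectralMeasureOf A) (hC : MeasurableSet C) (hx : x ∈ A.domain) :
    E.proj C x ∈ A.domain := by
  rw [h.mem_domain_iff, E.measure_proj x hC]
  exact ((h.mem_domain_iff x).1 hx).restrict

theorem proj_mem_domain_of_bounded (h : E.IsSpectralMeasureOf A) (hC : MeasurableSet C) {M : ℝ}
    (hM : ∀ l ∈ C, |l| ≤ M) (x : H) : E.proj C x ∈ A.domain := by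
  rw [h.mem_domain_iff, E.measure_proj x hC]
  refine (integrable_const (M ^ 2)).mono' (by fun_prop) ?_
  filter_upwards [ae_restrict_mem hC] with l hl
  have := hM l hl
  rw [Real.norm_of_nonneg (by positivity), ← sq_abs]
  gcongr

theorem re_inner_apply (h : E.IsSpectralMeasureOf A) (x : A.domain) :
    RCLike.re ⟪(x : H), A x⟫_ℂ = ∫ l : ℝ, l ∂E.measure (x : H) := by
  rw [h.inner_apply x]
  exact Complex.ofReal_re _

theorem le_re_inner_apply (h : E.IsSpectralMeasureOf A) (hC : MeasurableSet C) {m : ℝ}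
    (hm : ∀ l ∈ C, m ≤ l) (x : A.domain) (hx : E.proj C (x : H) = x) :
    m * ‖(x : H)‖ ^ 2 ≤ RCLike.re ⟪(x : H), A x⟫_ℂ := by
  have := integral_mono_ae (integrable_const m) (h.integrable_id x)
    ((E.ae_mem hC hx).mono hm)
  rw [h.re_inner_apply x]
  rwa [integral_const, E.real_measure_univ, smul_eq_mul, mul_comm] at this

theorem re_inner_apply_le (h : E.IsSpectralMeasureOf A) (hC : MeasurableSet C) {m : ℝ}
    (hm : ∀ l ∈ C, l ≤ m) (x : A.domain) (hx : E.proj C (x : H) = x) :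
    RCLike.re ⟪(x : H), A x⟫_ℂ ≤ m * ‖(x : H)‖ ^ 2 := by
  have := integral_mono_ae (h.integrable_id x) (integrable_const m)
    ((E.ae_mem hC hx).mono hm)
  rw [h.re_inner_apply x]
  rwa [integral_const, E.real_measure_univ, smul_eq_mul, mul_comm] at this

/-- The spectral measure gives only diagonal values of the form. Since the measures of `x` and `y`
add up to that of `x + y`, the cross terms cancel, but only in real part; the imaginary part follows
by using `Complex.I • y`. -/
theorem re_inner_apply_eq_zero (h : E.IsSpectralMeasureOf A) (hA : A.IsFormalAdjoint A)
    (hC : MeasurableSet C) (x y : A.domain) (hx : E.proj C (x : H) = x)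
    (hy : E.proj C (y : H) = 0) : RCLike.re ⟪(y : H), A x⟫_ℂ = 0 := by
  have h1 := h.re_inner_apply (x + y)
  rw [Submodule.coe_add, E.measure_add hC hx hy, integral_add_measure (h.integrable_id x)
    (h.integrable_id y), ← h.re_inner_apply x, ← h.re_inner_apply y, LinearPMap.map_add, inner_add_left,
    inner_add_right, inner_add_right, map_add, map_add, map_add, ← hA x y,
    inner_re_symm (A x) (y : H)] at h1
  linarith

theorem inner_apply_eq_zero (h : E.IsSpectralMeasureOf A) (hA : A.IsFormalAdjoint A)
    (hC : MeasurableSet C) (x y : A.domain) (hx : E.proj C (x : H) = x)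
    (hy : E.proj C (y : H) = 0) : ⟪(y : H), A x⟫_ℂ = 0 := by
  have h1 := h.re_inner_apply_eq_zero hA hC x y hx hy
  have h2 := h.re_inner_apply_eq_zero hA hC x (Complex.I • y) hx (by simp [hy])
  rw [Submodule.coe_smul, inner_smul_left] at h2
  apply Complex.ext
  · simpa using h1
  · simpa using h2

/-- The component of `A x` in the complementary spectral subspace is orthogonal to the dense domain.
-/
theorem proj_apply_eq_self (h : E.IsSpectralMeasureOf A) (hA : A.IsFormalAdjoint A)
    (hd : Dense (A.domain : Set H)) (hC : MeasurableSet C) (x : A.domain)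
    (hx : E.proj C (x : H) = x) : E.proj C (A x) = A x := by
  have : E.proj Cᶜ (A x) = 0 := by
    refine hd.eq_zero_of_inner_right ℂ fun v hv => ?_
    rw [← inner_selfAdjoint_apply_left (E.isSelfAdjoint_proj hC.compl)]
    refine h.inner_apply_eq_zero hA hC x ⟨_, h.proj_mem_domain hC.compl hv⟩ hx ?_
    change (E.proj C * E.proj Cᶜ) v = 0
    rw [E.proj_mul_eq_zero hC hC.compl disjoint_compl_right]
    simp
  rw [E.proj_compl hC, sub_apply, one_apply_eq_self, sub_eq_zero] at this
  exact this.symm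

/-- On the spectral subspace the form of `A - c` lies between `-δ` and `δ`; polarization turns this
into a norm bound, tested against `v = (A - c) x`. This `v` lies in the domain because `C` is
bounded. -/
theorem norm_apply_sub_smul_le (h : E.IsSpectralMeasureOf A) (hA : A.IsFormalAdjoint A)
    (hd : Dense (A.domain : Set H)) (hC : MeasurableSet C) {c δ : ℝ}
    (hc : ∀ l ∈ C, |l - c| ≤ δ) (x : A.domain) (hx : E.proj C (x : H) = x) :
    ‖A x - (c : ℂ) • (x : H)‖ ≤ δ * ‖(x : H)‖ := by
  have hlo : ∀ l ∈ C, c - δ ≤ l := fun l hl => by linarith [(abs_le.1 (hc l hl)).1]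
  have hhi : ∀ l ∈ C, l ≤ c + δ := fun l hl => by linarith [(abs_le.1 (hc l hl)).2]
  set v := A x - (c : ℂ) • (x : H) with hv
  have hvC : E.proj C v = v := by
    rw [hv, map_sub, map_smul, hx, h.proj_apply_eq_self hA hd hC x hx]
  have hvd : v ∈ A.domain := by
    rw [← hvC]
    refine h.proj_mem_domain_of_bounded hC (M := |c| + δ) (fun l hl => ?_) v
    have h1 := hc l hl
    have h2 := abs_add_le (l - c) c
    rw [sub_add_cancel] at h2
    linarith
  -- Subtract the form bounds at `x + t v` and `x - t v` and apply the parallelogram law.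
  have key (t : ℝ) : 2 * (t * ‖v‖ ^ 2) ≤ δ * (‖(x : H)‖ ^ 2 + t ^ 2 * ‖v‖ ^ 2) := by
    set y : A.domain := (t : ℂ) • ⟨v, hvd⟩ with hy
    have hyc : (y : H) = (t : ℂ) • v := rfl
    have hyC : E.proj C (y : H) = y := by rw [hyc, map_smul, hvC]
    have h1 := h.re_inner_apply_le hC hhi (x + y) (by simp [hx, hyC])
    have h2 := h.le_re_inner_apply hC hlo (x - y) (by simp [hx, hyC])
    have h3 : RCLike.re ⟪(x : H), A y⟫_ℂ = RCLike.re ⟪(y : H), A x⟫_ℂ := by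
      rw [← hA x y, ← inner_conj_symm, RCLike.conj_re]
    have h4 : RCLike.re ⟪(y : H), A x⟫_ℂ = t * ‖v‖ ^ 2 + c * RCLike.re ⟪(y : H), (x : H)⟫_ℂ := by
      have : A x = v + (c : ℂ) • (x : H) := by rw [hv, sub_add_cancel]
      have hr : RCLike.re ⟪v, v⟫_ℂ = ‖v‖ ^ 2 := inner_self_eq_norm_sq (𝕜 := ℂ) v
      rw [this, inner_add_right, inner_smul_right, map_add, hyc, inner_smul_left,
        Complex.conj_ofReal, ← hr]
      simp only [RCLike.re_to_complex, Complex.re_ofReal_mul]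
    have h5 : ‖(y : H)‖ ^ 2 = t ^ 2 * ‖v‖ ^ 2 := by
      rw [hyc, norm_smul, mul_pow, Complex.norm_real, Real.norm_eq_abs, sq_abs]
    have h6 : RCLike.re ⟪(x : H), (y : H)⟫_ℂ = RCLike.re ⟪(y : H), (x : H)⟫_ℂ :=
      inner_re_symm _ _
    have h7 := norm_add_sq (𝕜 := ℂ) (x : H) (y : H)
    have h8 := norm_sub_sq (𝕜 := ℂ) (x : H) (y : H)
    rw [LinearPMap.map_add, Submodule.coe_add, inner_add_left, inner_add_right, inner_add_right, map_add,
      map_add, map_add, h7, h6, h3, h4, h5] at h1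
    rw [LinearPMap.map_sub, Submodule.coe_sub, inner_sub_left, inner_sub_right, inner_sub_right, map_sub,
      map_sub, map_sub, h8, h6, h3, h4, h5] at h2
    linarith
  rcases (norm_nonneg v).eq_or_lt with h0 | h0
  · have h1 := key 0
    rw [← h0]
    by_cases hx0 : ‖(x : H)‖ = 0
    · simp [hx0]
    have : 0 < ‖(x : H)‖ := lt_of_le_of_ne (norm_nonneg _) (Ne.symm hx0)
    by_contra! hneg
    have : 0 ≤ δ * ‖(x : H)‖ * ‖(x : H)‖ := by nlinarith
    nlinarith
  · by_cases hx0 : ‖(x : H)‖ = 0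
    · exfalso
      have hz : x = 0 := by
        ext
        simpa using hx0
      rw [hv, hz] at h0
      simp at h0
    have hxp : 0 < ‖(x : H)‖ := lt_of_le_of_ne (norm_nonneg _) (Ne.symm hx0)
    -- The optimal `t` makes `t v` as long as `x`.
    have h1 := key (‖(x : H)‖ / ‖v‖)
    have e1 : ‖(x : H)‖ / ‖v‖ * ‖v‖ ^ 2 = ‖(x : H)‖ * ‖v‖ := by field_simp
    have e2 : (‖(x : H)‖ / ‖v‖) ^ 2 * ‖v‖ ^ 2 = ‖(x : H)‖ ^ 2 := by field_simp
    rw [e1, e2] at h1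
    refine le_of_mul_le_mul_left ?_ hxp
    linarith

end IsSpectralMeasureOf

end ProjectionValuedMeasure

/-! ### Monotonicity of spectral projections -/

section Key

set_option linter.unusedSectionVars false

variable {ι : Type*} {b : HilbertBasis ι ℂ H} {S X D W : H →L[ℂ] H}

theorem mul_norm_le_add_of_forall {a : ℝ}
    (h : ∀ x, a * ‖S x‖ ^ 2 + RCLike.re ⟪S x, S (D x)⟫_ℂ ≤ RCLike.re ⟪S x, X x⟫_ℂ) (x : H) :
    a * ‖S x‖ ≤ ‖X x‖ + ‖S (D x)‖ := by
  rcases (norm_nonneg (S x)).eq_or_lt with h0 | h0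
  · rw [← h0, mul_zero]
    positivity
  have h1 := h x
  have h2 := (RCLike.re_le_norm _).trans (norm_inner_le_norm (𝕜 := ℂ) (S x) (X x))
  have h3 := (RCLike.re_le_norm _).trans (norm_inner_le_norm (𝕜 := ℂ) (-S x) (S (D x)))
  rw [inner_neg_left, map_neg, norm_neg] at h3
  refine le_of_mul_le_mul_left ?_ h0
  nlinarith

/-- Formally, `S D` is absorbed into the left side because `‖D‖ ≤ a / 3`. As `S` is not yet known to
be Hilbert–Schmidt, the inequality is iterated on finite partial sums instead, where the unknown
term shrinks geometrically. -/
theorem isHS_of_forall {a δ : ℝ} (ha : 0 < a) (hδ : 3 * δ ≤ a) (hD : ‖D‖ ≤ δ) (hX : IsHS b X)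
    (h : ∀ x, a * ‖S x‖ ≤ ‖X x‖ + ‖S (D x)‖) : IsHS b S := by
  have hsq (x : H) : ‖S x‖ ^ 2 ≤ 2 / a ^ 2 * ‖X x‖ ^ 2 + 2 / a ^ 2 * ‖S (D x)‖ ^ 2 := by
    have h1 := pow_le_pow_left₀ (by positivity) (h x) 2
    rw [← mul_add, div_mul_eq_mul_div, le_div_iff₀ (by positivity)]
    nlinarith [sq_nonneg (‖X x‖ - ‖S (D x)‖)]
  have hδ0 : 0 ≤ δ := (norm_nonneg _).trans hD
  have hDsq : 2 / a ^ 2 * ‖D‖ ^ 2 ≤ 1 / 2 := by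
    have : ‖D‖ ^ 2 ≤ (a / 3) ^ 2 := by
      gcongr
      linarith
    rw [div_mul_eq_mul_div, div_le_iff₀ (by positivity)]
    nlinarith
  -- The arbitrary `C` lets the induction pass from `C` to `D * C`. The constant `4 / a ^ 2` is the
  -- fixed point of `z ↦ 2 / a ^ 2 + z / 2`.
  have key (J : Finset ι) (N : ℕ) : ∀ C : H →L[ℂ] H, ∑ i ∈ J, ‖S (C (b i))‖ ^ 2 ≤
      ‖C‖ ^ 2 * (4 / a ^ 2 * hsSq b X + (1 / 2) ^ N * (J.card * ‖S‖ ^ 2)) := by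
    induction N with
    | zero =>
      intro C
      have : ∑ i ∈ J, ‖S (C (b i))‖ ^ 2 ≤ ∑ i ∈ J, (‖S‖ * ‖C‖) ^ 2 := by
        refine Finset.sum_le_sum fun i _ => ?_
        gcongr
        have h1 := S.le_opNorm (C (b i))
        have h2 := C.le_opNorm (b i)
        rw [b.orthonormal.1 i, mul_one] at h2
        exact h1.trans (by gcongr)
      rw [Finset.sum_const, nsmul_eq_mul] at this
      have h0 : 0 ≤ ‖C‖ ^ 2 * (4 / a ^ 2 * hsSq b X) :=
        mul_nonneg (by positivity) (mul_nonneg (by positivity) hsSq_nonneg)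
      rw [mul_add, pow_zero, one_mul]
      linarith [show (J.card : ℝ) * (‖S‖ * ‖C‖) ^ 2 = ‖C‖ ^ 2 * (J.card * ‖S‖ ^ 2) by ring]
    | succ N ih =>
      intro C
      have h1 := ih (D * C)
      set Z := 4 / a ^ 2 * hsSq b X + (1 / 2) ^ N * (J.card * ‖S‖ ^ 2) with hZ
      have hZ0 : 0 ≤ Z := add_nonneg (mul_nonneg (by positivity) hsSq_nonneg) (by positivity)
      have h2 : ∑ i ∈ J, ‖X (C (b i))‖ ^ 2 ≤ ‖C‖ ^ 2 * hsSq b X :=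
        ((hX.mul_right C).summable.sum_le_tsum J fun _ _ => by positivity).trans
          (hX.hsSq_mul_right_le C)
      have h3 : ‖D * C‖ ^ 2 ≤ ‖D‖ ^ 2 * ‖C‖ ^ 2 := by
        rw [← mul_pow]
        gcongr
        exact norm_mul_le _ _
      calc ∑ i ∈ J, ‖S (C (b i))‖ ^ 2
          ≤ ∑ i ∈ J, (2 / a ^ 2 * ‖X (C (b i))‖ ^ 2 + 2 / a ^ 2 * ‖S (D (C (b i)))‖ ^ 2) :=
            Finset.sum_le_sum fun i _ => hsq _
        _ = 2 / a ^ 2 * ∑ i ∈ J, ‖X (C (b i))‖ ^ 2 +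
            2 / a ^ 2 * ∑ i ∈ J, ‖S ((D * C) (b i))‖ ^ 2 := by
            rw [Finset.sum_add_distrib, Finset.mul_sum, Finset.mul_sum]
            rfl
        _ ≤ 2 / a ^ 2 * (‖C‖ ^ 2 * hsSq b X) + 2 / a ^ 2 * (‖D‖ ^ 2 * ‖C‖ ^ 2 * Z) := by
            gcongr
            exact h1.trans (by gcongr)
        _ = 2 / a ^ 2 * (‖C‖ ^ 2 * hsSq b X) + 2 / a ^ 2 * ‖D‖ ^ 2 * (‖C‖ ^ 2 * Z) := by ring
        _ ≤ 2 / a ^ 2 * (‖C‖ ^ 2 * hsSq b X) + 1 / 2 * (‖C‖ ^ 2 * Z) := by gcongr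
        _ = _ := by
            rw [hZ]
            ring
  refine summable_of_sum_le (c := 4 / a ^ 2 * hsSq b X) (fun _ => by positivity) fun J => ?_
  have hlim : Tendsto (fun N : ℕ => ‖(1 : H →L[ℂ] H)‖ ^ 2 *
      (4 / a ^ 2 * hsSq b X + (1 / 2) ^ N * (J.card * ‖S‖ ^ 2))) atTop
      (𝓝 (‖(1 : H →L[ℂ] H)‖ ^ 2 * (4 / a ^ 2 * hsSq b X + 0 * (J.card * ‖S‖ ^ 2)))) :=
    (((tendsto_pow_atTop_nhds_zero_of_lt_one (by norm_num) (by norm_num)).mul_const _).const_add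
      _).const_mul _
  refine (ge_of_tendsto' hlim fun N => key J N 1).trans ?_
  rw [zero_mul, add_zero]
  refine mul_le_of_le_one_left (mul_nonneg (by positivity) hsSq_nonneg) ?_
  exact pow_le_one₀ (norm_nonneg _) ContinuousLinearMap.norm_id_le

/-- Once `S` is Hilbert–Schmidt, summing the hypothesis over the basis leaves `a ‖S‖² - ‖S‖ ‖S D‖`
in Hilbert–Schmidt norms, and `‖S D‖ ≤ a ‖S‖`. -/
theorem tsum_re_inner_nonneg_of_forall {a δ : ℝ} (ha : 0 < a) (hδ : 3 * δ ≤ a) (hD : ‖D‖ ≤ δ)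
    (hX : IsHS b X)
    (h : ∀ x, a * ‖S x‖ ^ 2 + RCLike.re ⟪S x, S (D x)⟫_ℂ ≤ RCLike.re ⟪S x, X x⟫_ℂ) :
    0 ≤ (∑' i, ⟪S (b i), X (b i)⟫_ℂ).re := by
  have hS : IsHS b S := isHS_of_forall ha hδ hD hX (mul_norm_le_add_of_forall h)
  have hSD := hS.mul_right D
  have hsum := hS.summable_inner hX
  rw [Complex.re_tsum hsum]
  have hterm (i) : a / 2 * ‖S (b i)‖ ^ 2 - 1 / (2 * a) * ‖(S * D) (b i)‖ ^ 2 ≤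
      (⟪S (b i), X (b i)⟫_ℂ).re := by
    refine le_trans ?_ (h (b i))
    have h3 := (RCLike.re_le_norm _).trans (norm_inner_le_norm (𝕜 := ℂ) (-S (b i)) (S (D (b i))))
    rw [inner_neg_left, map_neg, norm_neg] at h3
    have h4 : ‖S (b i)‖ * ‖S (D (b i))‖ ≤
        a / 2 * ‖S (b i)‖ ^ 2 + 1 / (2 * a) * ‖S (D (b i))‖ ^ 2 := by
      have : a / 2 * ‖S (b i)‖ ^ 2 + 1 / (2 * a) * ‖S (D (b i))‖ ^ 2 -
          ‖S (b i)‖ * ‖S (D (b i))‖ = (a * ‖S (b i)‖ - ‖S (D (b i))‖) ^ 2 / (2 * a) := by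
        field_simp
        ring
      have : 0 ≤ (a * ‖S (b i)‖ - ‖S (D (b i))‖) ^ 2 / (2 * a) := by positivity
      linarith
    rw [mul_apply_eq_comp]
    linarith
  have hs1 := hS.summable.mul_left (a / 2)
  have hs2 := hSD.summable.mul_left (1 / (2 * a))
  refine le_trans ?_ ((hs1.sub hs2).tsum_le_tsum hterm (Complex.hasSum_re hsum.hasSum).summable)
  rw [hs1.tsum_sub hs2, tsum_mul_left, tsum_mul_left, ← hsSq, ← hsSq]
  have h5 := hS.hsSq_mul_right_le D
  have hδ0 : 0 ≤ δ := (norm_nonneg _).trans hD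
  have h6 : ‖D‖ ^ 2 ≤ a ^ 2 := by
    gcongr
    linarith
  have h7 : hsSq b (S * D) ≤ a ^ 2 * hsSq b S :=
    h5.trans (mul_le_mul_of_nonneg_right h6 hsSq_nonneg)
  have h8 : 1 / (2 * a) * hsSq b (S * D) ≤ 1 / (2 * a) * (a ^ 2 * hsSq b S) := by gcongr
  have h9 : 1 / (2 * a) * (a ^ 2 * hsSq b S) = a / 2 * hsSq b S := by field_simp
  linarith

/-! ### Spectral windows and the trace inequality for `B = A + W` -/

variable {E E' : ProjectionValuedMeasure H} {A B : H →ₗ.[ℂ] H}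

/-- Here `D = (c - A) F` for the window projection `F`. The identity `F D = D` later makes the error
term `Q D` equal to `(Q F) D`, of the form `S D`. -/
theorem exists_bounded_of_isSpectralMeasureOf (hE : E.IsSpectralMeasureOf A)
    (hA : A.IsFormalAdjoint A) (hd : Dense (A.domain : Set H)) {C : Set ℝ} (hC : MeasurableSet C)
    {c δ : ℝ} (hδ : 0 ≤ δ) (hc : ∀ l ∈ C, |l - c| ≤ δ) (hdom : ∀ x, E.proj C x ∈ A.domain) :
    ∃ D : H →L[ℂ] H, ‖D‖ ≤ δ ∧ E.proj C * D = D ∧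
      ∀ x, A ⟨E.proj C x, hdom x⟩ = (c : ℂ) • E.proj C x - D x := by
  have hPP (x : H) : E.proj C (E.proj C x) = E.proj C x := by
    rw [← mul_apply_eq_comp, E.proj_mul_self hC]
  let D₀ : H →ₗ[ℂ] H :=
    { toFun := fun x => (c : ℂ) • E.proj C x - A ⟨E.proj C x, hdom x⟩
      map_add' := fun x y => by
        have : (⟨E.proj C (x + y), hdom (x + y)⟩ : A.domain) =
            ⟨E.proj C x, hdom x⟩ + ⟨E.proj C y, hdom y⟩ := by
          ext
          simp
        rw [this, LinearPMap.map_add, map_add, smul_add]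
        abel
      map_smul' := fun t x => by
        have : (⟨E.proj C (t • x), hdom (t • x)⟩ : A.domain) = t • ⟨E.proj C x, hdom x⟩ := by
          ext
          simp
        rw [this, LinearPMap.map_smul, map_smul, RingHom.id_apply, smul_sub, smul_comm] }
  have hb (x : H) : ‖D₀ x‖ ≤ δ * ‖x‖ := by
    have h1 := hE.norm_apply_sub_smul_le hA hd hC hc ⟨E.proj C x, hdom x⟩ (hPP x)
    rw [norm_sub_rev] at h1
    exact h1.trans (by gcongr; exact E.norm_proj_apply_le hC x)
  refine ⟨D₀.mkContinuous δ hb, D₀.mkContinuous_norm_le hδ hb, ?_, fun x => ?_⟩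
  · ext x
    change E.proj C ((c : ℂ) • E.proj C x - A ⟨E.proj C x, hdom x⟩) =
      (c : ℂ) • E.proj C x - A ⟨E.proj C x, hdom x⟩
    rw [map_sub, map_smul, hPP,
      hE.proj_apply_eq_self hA hd hC ⟨E.proj C x, hdom x⟩ (hPP x)]
  · change _ = (c : ℂ) • E.proj C x - ((c : ℂ) • E.proj C x - A ⟨E.proj C x, hdom x⟩)
    rw [sub_sub_cancel]

/-- The contribution of a spectral window of `A` below `μ` and of the part of `B` above `μ`. -/
theorem re_diagSum_window_nonneg (hE : E.IsSpectralMeasureOf A) (hE' : E'.IsSpectralMeasureOf B)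
    (hA : A.IsFormalAdjoint A) (hB : B.IsFormalAdjoint B) (hd : Dense (A.domain : Set H))
    (hAB : A.domain ≤ B.domain) (hW : IsNuclear b W)
    (hBW : ∀ x (h : x ∈ A.domain), B ⟨x, hAB h⟩ = A ⟨x, h⟩ + W x)
    {C : Set ℝ} (hC : MeasurableSet C) {c δ μ : ℝ} (hδ : 0 < δ) (hc : ∀ l ∈ C, |l - c| ≤ δ)
    (hμ : 3 * δ ≤ μ - c) :
    0 ≤ (diagSum b (W * (E.proj C * E'.proj (Ici μ)))).re := by
  have hM : ∀ l ∈ C, |l| ≤ |c| + δ := fun l hl => by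
    have h1 := hc l hl
    have h2 := abs_add_le (l - c) c
    rw [sub_add_cancel] at h2
    linarith
  have hdom := hE.proj_mem_domain_of_bounded hC hM
  obtain ⟨D, hD, hFD, hAD⟩ := exists_bounded_of_isSpectralMeasureOf hE hA hd hC hδ.le hc hdom
  have hQ : MeasurableSet (Ici μ) := measurableSet_Ici
  have hQsa := E'.isSelfAdjoint_proj hQ
  have hQQ := E'.proj_mul_self hQ
  have hFsa := E.isSelfAdjoint_proj hC
  have hFF := E.proj_mul_self hC
  set F := E.proj C with hF
  set Q := E'.proj (Ici μ) with hQdef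
  have hX : IsHS b (Q * W * F) := (hW.isHS.mul_left Q).mul_right F
  -- On the range of `F`, `W = B - A` with `A F = c F - D`, while `B` is reduced by `Q` and is at
  -- least `μ` on its range.
  have key (x : H) : (μ - c) * ‖(Q * F) x‖ ^ 2 + RCLike.re ⟪(Q * F) x, (Q * F) (D x)⟫_ℂ ≤
      RCLike.re ⟪(Q * F) x, (Q * W * F) x⟫_ℂ := by
    have hQQx (y : H) : Q (Q y) = Q y := by rw [← mul_apply_eq_comp, hQQ]
    have hFDx : F (D x) = D x := by rw [← mul_apply_eq_comp, hFD]
    have hFx : F x ∈ B.domain := hAB (hdom x)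
    have hQFx : Q (F x) ∈ B.domain := hE'.proj_mem_domain hQ hFx
    have hsub : F x - Q (F x) ∈ B.domain := B.domain.sub_mem hFx hQFx
    have h1 : ⟪Q (F x), B ⟨F x, hFx⟩⟫_ℂ = ⟪Q (F x), B ⟨Q (F x), hQFx⟩⟫_ℂ := by
      have h2 := hE'.inner_apply_eq_zero hB hQ ⟨Q (F x), hQFx⟩ ⟨F x - Q (F x), hsub⟩
        (hQQx _) (by simp only [map_sub]; rw [← hQdef, hQQx, sub_self])
      have h3 : (⟨F x, hFx⟩ : B.domain) = ⟨Q (F x), hQFx⟩ + ⟨F x - Q (F x), hsub⟩ := by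
        ext
        simp
      rw [h3, LinearPMap.map_add, inner_add_right,
        ← hB ⟨Q (F x), hQFx⟩ ⟨F x - Q (F x), hsub⟩, ← inner_conj_symm (B ⟨Q (F x), hQFx⟩), h2,
        map_zero, add_zero]
    have h4 := hE'.le_re_inner_apply hQ (m := μ) (fun l hl => hl) ⟨Q (F x), hQFx⟩ (hQQx _)
    simp only at h4
    have h5 : W (F x) = B ⟨F x, hFx⟩ - (c : ℂ) • F x + D x := by
      rw [hBW (F x) (hdom x), hAD x]
      abel
    have h6 : ⟪Q (F x), Q (W (F x))⟫_ℂ = ⟪Q (F x), W (F x)⟫_ℂ := by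
      rw [← inner_selfAdjoint_apply_left hQsa, hQQx]
    have h7 : ⟪Q (F x), F x⟫_ℂ = (‖Q (F x)‖ ^ 2 : ℝ) := by
      have h8 := inner_self_eq_norm_sq_to_K (𝕜 := ℂ) (Q (F x))
      rw [← inner_selfAdjoint_apply_left hQsa, hQQx] at h8
      rw [h8]
      push_cast
      rfl
    have h9 : ⟪Q (F x), D x⟫_ℂ = ⟪Q (F x), Q (F (D x))⟫_ℂ := by
      rw [hFDx, ← inner_selfAdjoint_apply_left hQsa, hQQx]
    simp only [mul_apply_eq_comp]
    rw [h6, h5, inner_add_right, inner_sub_right, h1, inner_smul_right, h7, h9]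
    simp only [map_add, map_sub, ← Complex.ofReal_mul, RCLike.re_to_complex,
      Complex.ofReal_re] at h4 ⊢
    linarith
  have hpos := tsum_re_inner_nonneg_of_forall (by linarith : 0 < μ - c) hμ hD hX key
  -- By cyclicity and `F F = F`, `tr(W F Q) = tr(F Q W F)`, which is the pairing of `Q F` with `Q W
  -- F`.
  have htr := (hW.hasSum_inner_mul_mul (F * Q) F).tsum_eq
  rw [← mul_assoc F F Q, hFF] at htr
  rw [← htr]
  convert hpos using 4 with i
  simp only [mul_apply_eq_comp]
  rw [inner_selfAdjoint_apply_left hQsa, inner_selfAdjoint_apply_left hFsa,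
    ← mul_apply_eq_comp Q Q, hQQ]

/-- The dyadic windows `[μ - 2 ^ (k + 1), μ - 2 ^ k)` partition `(-∞, μ)`. -/
theorem iUnion_Ico_sub_zpow (μ : ℝ) :
    ⋃ k : ℤ, Ico (μ - 2 ^ (k + 1)) (μ - 2 ^ k) = Iio μ := by
  ext t
  simp only [mem_iUnion, mem_Ico, mem_Iio]
  constructor
  · rintro ⟨k, -, h⟩
    have : (0 : ℝ) < 2 ^ k := by positivity
    linarith
  · intro h
    obtain ⟨k, h1, h2⟩ := exists_mem_Ioc_zpow (x := μ - t) (y := 2) (by linarith) (by norm_num)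
    exact ⟨k, by linarith, by linarith⟩

theorem pairwise_disjoint_Ico_sub_zpow (μ : ℝ) :
    Pairwise (Function.onFun Disjoint fun k : ℤ => Ico (μ - 2 ^ (k + 1)) (μ - 2 ^ k)) := by
  have aux (k l : ℤ) (h : k < l) :
      Disjoint (Ico (μ - 2 ^ (k + 1)) (μ - 2 ^ k)) (Ico (μ - 2 ^ (l + 1)) (μ - 2 ^ l)) := by
    refine Set.disjoint_left.2 fun t ht ht' => ?_
    have : (2 : ℝ) ^ (k + 1) ≤ 2 ^ l := zpow_le_zpow_right₀ (by norm_num) (by omega)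
    linarith [ht.1, ht'.2]
  intro k l hkl
  rcases lt_or_gt_of_ne hkl with h | h
  · exact aux k l h
  · exact (aux l k h).symm

theorem re_diagSum_mul_proj_mul_proj_nonneg (hE : E.IsSpectralMeasureOf A)
    (hE' : E'.IsSpectralMeasureOf B)
    (hA : A.IsFormalAdjoint A) (hB : B.IsFormalAdjoint B) (hd : Dense (A.domain : Set H))
    (hAB : A.domain ≤ B.domain) (hW : IsNuclear b W)
    (hBW : ∀ x (h : x ∈ A.domain), B ⟨x, hAB h⟩ = A ⟨x, h⟩ + W x) (μ : ℝ) :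
    0 ≤ (diagSum b (W * (E.proj (Iio μ) * E'.proj (Ici μ)))).re := by
  -- The windows are indexed by `ℤ`, accumulating at `μ` and running off to `-∞`; countable
  -- additivity needs a sequence over `ℕ`.
  let Γ : ℕ → Set ℝ := fun n =>
    Ico (μ - 2 ^ (Equiv.intEquivNat.symm n + 1)) (μ - 2 ^ (Equiv.intEquivNat.symm n))
  have hΓ (n) : MeasurableSet (Γ n) := measurableSet_Ico
  have hΓd : Pairwise (Function.onFun Disjoint Γ) := fun m n hmn =>
    pairwise_disjoint_Ico_sub_zpow μ (Equiv.intEquivNat.symm.injective.ne hmn)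
  have hΓU : ⋃ n, Γ n = Iio μ := by
    rw [← iUnion_Ico_sub_zpow μ]
    exact Equiv.intEquivNat.symm.surjective.iUnion_comp
      fun k : ℤ => Ico (μ - 2 ^ (k + 1)) (μ - 2 ^ k)
  set Q := E'.proj (Ici μ)
  have hlim : Tendsto (fun N => diagSum b (W * ((∑ n ∈ Finset.range N, E.proj (Γ n)) * Q))) atTop
      (𝓝 (diagSum b (W * (E.proj (Iio μ) * Q)))) := by
    refine hW.tendsto_diagSum_mul (M := 1) (fun N => ?_) fun x => ?_
    · rw [← E.proj_biUnion_finset hΓ hΓd]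
      refine (norm_mul_le _ _).trans ?_
      exact mul_le_one₀ (E.norm_proj_le (Finset.measurableSet_biUnion _ fun n _ => hΓ n))
        (norm_nonneg _) (E'.norm_proj_le measurableSet_Ici)
    · have := (E.hasSum_iUnion Γ hΓ hΓd (Q x)).tendsto_sum_nat
      rw [hΓU] at this
      simpa using this
  refine ge_of_tendsto' ((Complex.continuous_re.tendsto _).comp hlim) fun N => ?_
  rw [Function.comp_apply, Finset.sum_mul, hW.diagSum_mul_sum, Complex.re_sum]
  refine Finset.sum_nonneg fun n _ => ?_
  set k := Equiv.intEquivNat.symm n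
  have hk : (0 : ℝ) < 2 ^ k := by positivity
  have hk1 : (2 : ℝ) ^ (k + 1) = 2 * 2 ^ k := by rw [zpow_add_one₀ (by norm_num), mul_comm]
  -- Midpoint and half-width of the window; at every scale `μ - c` is exactly `3 δ`.
  refine re_diagSum_window_nonneg hE hE' hA hB hd hAB hW hBW (hΓ n) (c := μ - 3 / 2 * 2 ^ k)
    (δ := 2 ^ k / 2) (by positivity) (fun l hl => ?_) (by linarith)
  have h1 : μ - 2 ^ (k + 1) ≤ l := hl.1
  have h2 : l < μ - 2 ^ k := hl.2
  rw [abs_le]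
  constructor <;> linarith

/-- Replacing `A` by `B = A + W` moves the spectral subspace below `μ` against `W`. -/
theorem re_diagSum_mul_proj_sub_nonneg (hE : E.IsSpectralMeasureOf A)
    (hE' : E'.IsSpectralMeasureOf B)
    (hA : A.IsFormalAdjoint A) (hB : B.IsFormalAdjoint B) (hd : Dense (A.domain : Set H))
    (hAB : A.domain = B.domain) (hW : IsNuclear b W)
    (hBW : ∀ x (h : x ∈ A.domain) (h' : x ∈ B.domain), B ⟨x, h'⟩ = A ⟨x, h⟩ + W x) (μ : ℝ) :
    0 ≤ (diagSum b (W * (E.proj (Iio μ) - E'.proj (Iio μ)))).re := by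
  have h1 := re_diagSum_mul_proj_mul_proj_nonneg hE hE' hA hB hd hAB.le hW
    (fun x h => hBW x h _) μ
  -- The roles of `A` and `B` are exchanged. Conjugating the trace reverses the order of the
  -- projections, giving `Re tr(W (1 - P) P') ≤ 0`.
  have h2 := re_diagSum_mul_proj_mul_proj_nonneg hE' hE hB hA (hAB ▸ hd) hAB.ge hW.neg
    (fun x h => by rw [hBW x (hAB.ge h) h, neg_apply, add_neg_cancel_right]) μ
  have hI : MeasurableSet (Iio μ) := measurableSet_Iio
  rw [← compl_Iio, E'.proj_compl hI] at h1
  rw [← compl_Iio, E.proj_compl hI, neg_mul, diagSum_neg, Complex.neg_re, ← Complex.conj_re,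
    hW.conj_diagSum_mul, star_mul, star_sub, star_one, (E.isSelfAdjoint_proj hI).star_eq,
    (E'.isSelfAdjoint_proj hI).star_eq] at h2
  have e : E.proj (Iio μ) - E'.proj (Iio μ) = E.proj (Iio μ) * (1 - E'.proj (Iio μ)) -
      (1 - E.proj (Iio μ)) * E'.proj (Iio μ) := by
    noncomm_ring
  rw [e, hW.diagSum_mul_sub, Complex.sub_re]
  linarith

end Key

/-! ### Spectral measures of representations of `C(X)` -/

section Representation

set_option linter.unusedSectionVars false

open scoped CompactlySupported

variable {X : Type*} [MetricSpace X] [CompactSpace X] [MeasurableSpace X] [BorelSpace X]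

/-- A real continuous function, viewed as a complex one. -/
def toComplexMap (u : C(X, ℝ)) : C(X, ℂ) := ⟨fun t => (u t : ℂ), by fun_prop⟩

variable (Φ : C(X, ℂ) →⋆ₐ[ℂ] (H →L[ℂ] H))

theorem inner_star_mul_apply (f : C(X, ℂ)) (x : H) :
    ⟪x, Φ (star f * f) x⟫_ℂ = (‖Φ f x‖ ^ 2 : ℝ) := by
  rw [map_mul, map_star, mul_apply_eq_comp, ← inner_star_apply, star_star,
    inner_self_eq_norm_sq_to_K (𝕜 := ℂ)]
  push_cast
  rfl

theorem re_inner_toComplexMap_nonneg {u : C(X, ℝ)} (hu : ∀ t, 0 ≤ u t) (x : H) :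
    0 ≤ RCLike.re ⟪x, Φ (toComplexMap u) x⟫_ℂ := by
  let v : C(X, ℝ) := ⟨fun t => √(u t), by fun_prop⟩
  have : toComplexMap u = star (toComplexMap v) * toComplexMap v := by
    ext t
    simp only [toComplexMap, ContinuousMap.coe_mk, ContinuousMap.mul_apply,
      ContinuousMap.star_apply, RCLike.star_def, Complex.conj_ofReal, v]
    rw [← Complex.ofReal_mul, Real.mul_self_sqrt (hu t)]
  rw [this, inner_star_mul_apply]
  simp only [RCLike.re_to_complex, Complex.ofReal_re]
  positivity

theorem inner_toComplexMap_eq_re (u : C(X, ℝ)) (x : H) :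
    ⟪x, Φ (toComplexMap u) x⟫_ℂ = (RCLike.re ⟪x, Φ (toComplexMap u) x⟫_ℂ : ℝ) := by
  have hs : IsSelfAdjoint (Φ (toComplexMap u)) := by
    rw [IsSelfAdjoint, ← map_star]
    congr 1
    ext t
    simp [toComplexMap]
  refine (Complex.conj_eq_iff_re.1 ?_).symm
  rw [inner_conj_symm, inner_selfAdjoint_apply_left hs]

/-- Riesz–Markov for the positive functional `u ↦ ⟪x, Φ u x⟫` on real functions, extended to complex
ones by linearity. -/
theorem exists_repMeasure (x : H) :
    ∃ ν : Measure X, IsFiniteMeasure ν ∧ ∀ f : C(X, ℂ), ⟪x, Φ f x⟫_ℂ = ∫ t, f t ∂ν := by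
  let L : C_c(X, ℝ) →ₗ[ℝ] ℝ :=
    { toFun := fun u => RCLike.re ⟪x, Φ (toComplexMap (u : C(X, ℝ))) x⟫_ℂ
      map_add' := fun u v => by
        have : toComplexMap ((u + v : C_c(X, ℝ)) : C(X, ℝ)) =
            toComplexMap (u : C(X, ℝ)) + toComplexMap (v : C(X, ℝ)) := by
          ext t
          simp [toComplexMap]
        rw [this, map_add, add_apply, inner_add_right, map_add]
      map_smul' := fun c u => by
        have : toComplexMap ((c • u : C_c(X, ℝ)) : C(X, ℝ)) =
            (c : ℂ) • toComplexMap (u : C(X, ℝ)) := by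
          ext t
          simp [toComplexMap]
        rw [this, map_smul, smul_apply, inner_smul_right]
        simp }
  let P : C_c(X, ℝ) →ₚ[ℝ] ℝ := PositiveLinearMap.mk₀ L fun u hu =>
    re_inner_toComplexMap_nonneg Φ (u := (u : C(X, ℝ))) (fun t => hu t) x
  refine ⟨RealRMK.rieszMeasure P, inferInstance, fun f => ?_⟩
  have hreal (u : C(X, ℝ)) :
      ⟪x, Φ (toComplexMap u) x⟫_ℂ = ∫ t, (u t : ℂ) ∂(RealRMK.rieszMeasure P) := by
    have h := RealRMK.integral_rieszMeasure P (CompactlySupportedContinuousMap.continuousMapEquiv u)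
    rw [integral_complex_ofReal, inner_toComplexMap_eq_re]
    exact congrArg _ h.symm
  let u : C(X, ℝ) := ⟨fun t => (f t).re, by fun_prop⟩
  let v : C(X, ℝ) := ⟨fun t => (f t).im, by fun_prop⟩
  have hf : f = toComplexMap u + Complex.I • toComplexMap v := by
    ext t
    simp [toComplexMap, u, v, mul_comm Complex.I, Complex.re_add_im]
  have hreal_int (w : C(X, ℝ)) : Integrable (fun t => (w t : ℂ)) (RealRMK.rieszMeasure P) :=
    (toComplexMap w).continuous.integrable_of_hasCompactSupport (HasCompactSupport.of_compactSpace _)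
  have e (t : X) : f t = (u t : ℂ) + Complex.I * (v t : ℂ) := by
    simp [u, v, mul_comm Complex.I, Complex.re_add_im]
  simp_rw [e]
  rw [integral_add (hreal_int u) ((hreal_int v).const_mul _), integral_const_mul, ← hreal, ← hreal]
  conv_lhs => rw [hf]
  rw [map_add, map_smul, add_apply, smul_apply, inner_add_right, inner_smul_right]

/-- The measure `ν` with `⟪x, Φ f x⟫ = ∫ f dν`. -/
def repMeasure (x : H) : Measure X := (exists_repMeasure Φ x).choose

instance (x : H) : IsFiniteMeasure (repMeasure Φ x) := (exists_repMeasure Φ x).choose_spec.1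

theorem inner_rep_apply (x : H) (f : C(X, ℂ)) : ⟪x, Φ f x⟫_ℂ = ∫ t, f t ∂repMeasure Φ x :=
  (exists_repMeasure Φ x).choose_spec.2 f

theorem memLp_two_continuousMap (f : C(X, ℂ)) (ν : Measure X) [IsFiniteMeasure ν] : MemLp f 2 ν :=
  f.continuous.memLp_of_hasCompactSupport (HasCompactSupport.of_compactSpace _)

theorem eLpNorm_two_eq_enorm_iff {ν : Measure X} {g : X → ℂ} (hg : MemLp g 2 ν) (v : H) :
    ‖v‖ₑ = eLpNorm g 2 ν ↔ ‖v‖ ^ 2 = ∫ t, ‖g t‖ ^ 2 ∂ν := by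
  have hI : 0 ≤ ∫ t, ‖g t‖ ^ 2 ∂ν := integral_nonneg fun _ => by positivity
  have h : eLpNorm g 2 ν = ENNReal.ofReal √(∫ t, ‖g t‖ ^ 2 ∂ν) := by
    rw [hg.eLpNorm_eq_integral_rpow_norm (by norm_num) (by norm_num), Real.sqrt_eq_rpow]
    simp
  rw [h, ← ofReal_norm, ENNReal.ofReal_eq_ofReal_iff (norm_nonneg _) (Real.sqrt_nonneg _),
    eq_comm, Real.sqrt_eq_iff_mul_self_eq hI (norm_nonneg _), ← sq, eq_comm]

theorem norm_rep_apply_sq (f : C(X, ℂ)) (x : H) :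
    ‖Φ f x‖ ^ 2 = ∫ t, ‖f t‖ ^ 2 ∂repMeasure Φ x := by
  have h := inner_rep_apply Φ x (star f * f)
  rw [inner_star_mul_apply] at h
  have e (t : X) : (star f * f) t = ((‖f t‖ ^ 2 : ℝ) : ℂ) := by
    simp [Complex.conj_mul']
  simp_rw [e] at h
  rw [integral_complex_ofReal] at h
  exact_mod_cast h

theorem enorm_rep_apply (f : C(X, ℂ)) (x : H) : ‖Φ f x‖ₑ = eLpNorm f 2 (repMeasure Φ x) :=
  (eLpNorm_two_eq_enorm_iff (memLp_two_continuousMap f _) _).2 (norm_rep_apply_sq Φ f x)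

theorem exists_continuousMap_eLpNorm_sub_le {ν : Measure X} [IsFiniteMeasure ν] {g : X → ℂ}
    (hg : MemLp g 2 ν) {ε : ℝ≥0∞} (hε : ε ≠ 0) :
    ∃ f : C(X, ℂ), eLpNorm (g - ⇑f) 2 ν ≤ ε := by
  obtain ⟨f, hf, -⟩ := hg.exists_boundedContinuous_eLpNorm_sub_le (by norm_num) hε
  exact ⟨f.toContinuousMap, hf⟩

/-- The map `f ↦ Φ f x` is isometric for the `L²` norm of the measure of `x`, and continuous
functions are dense there, so it extends to all of `L²`. -/
theorem exists_repVector (x : H) {g : X → ℂ} (hg : MemLp g 2 (repMeasure Φ x)) :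
    ∃ v : H, ∀ f : C(X, ℂ), ‖v - Φ f x‖ₑ = eLpNorm (g - ⇑f) 2 (repMeasure Φ x) := by
  set ν := repMeasure Φ x
  let T : C(X, ℂ) →ₗ[ℂ] H :=
    { toFun := fun f => Φ f x
      map_add' := fun f g => by simp
      map_smul' := fun c f => by simp }
  let e : C(X, ℂ) →L[ℂ] Lp ℂ 2 ν := ContinuousMap.toLp 2 ν ℂ
  have hd : DenseRange e := ContinuousMap.toLp_denseRange ℂ ν ℂ (by norm_num)
  have hcoe (f : C(X, ℂ)) : e f = (memLp_two_continuousMap f ν).toLp f := rfl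
  have hn (f : C(X, ℂ)) : ‖T f‖ = ‖e f‖ := by
    rw [hcoe, Lp.norm_toLp, ← enorm_rep_apply Φ f x, toReal_enorm]
    rfl
  let U : Lp ℂ 2 ν →L[ℂ] H := T.extendOfNorm e.toLinearMap
  have hU (f : C(X, ℂ)) : U (e f) = T f :=
    LinearMap.extendOfNorm_eq hd ⟨1, fun f => by rw [one_mul]; exact (hn f).le⟩ f
  have hUn (h : Lp ℂ 2 ν) : ‖U h‖ = ‖h‖ := by
    refine hd.induction_on h (isClosed_eq (by fun_prop) (by fun_prop)) fun f => ?_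
    rw [hU, hn]
  refine ⟨U (hg.toLp g), fun f => ?_⟩
  have h1 : U (hg.toLp g) - Φ f x = U ((hg.sub (memLp_two_continuousMap f ν)).toLp _) := by
    rw [MemLp.toLp_sub hg (memLp_two_continuousMap f ν), map_sub, ← hcoe, hU]
    rfl
  rw [h1, ← ofReal_norm, hUn, Lp.norm_toLp, ENNReal.ofReal_toReal]
  exact (hg.sub (memLp_two_continuousMap f ν)).eLpNorm_ne_top

open scoped Classical in
/-- The vector `g(Φ) x`, for `g` square integrable with respect to the measure of `x`. -/
def repVector (g : X → ℂ) (x : H) : H :=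
  if hg : MemLp g 2 (repMeasure Φ x) then (exists_repVector Φ x hg).choose else 0

theorem enorm_repVector_sub {g : X → ℂ} {x : H} (hg : MemLp g 2 (repMeasure Φ x)) (f : C(X, ℂ)) :
    ‖repVector Φ g x - Φ f x‖ₑ = eLpNorm (g - ⇑f) 2 (repMeasure Φ x) := by
  rw [repVector, dif_pos hg]
  exact (exists_repVector Φ x hg).choose_spec f

theorem norm_repVector_sub_sq {g : X → ℂ} {x : H} (hg : MemLp g 2 (repMeasure Φ x))
    (f : C(X, ℂ)) :
    ‖repVector Φ g x - Φ f x‖ ^ 2 = ∫ t, ‖g t - f t‖ ^ 2 ∂repMeasure Φ x :=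
  (eLpNorm_two_eq_enorm_iff (hg.sub (memLp_two_continuousMap f _)) _).1
    (enorm_repVector_sub Φ hg f)

theorem repVector_eq_of_ae_eq {g : X → ℂ} {x : H} {f : C(X, ℂ)}
    (h : g =ᵐ[repMeasure Φ x] f) : repVector Φ g x = Φ f x := by
  have hg : MemLp g 2 (repMeasure Φ x) := (memLp_congr_ae h).2 (memLp_two_continuousMap f _)
  have h1 := enorm_repVector_sub Φ hg f
  rw [eLpNorm_congr_ae (g := 0) (h.mono fun t ht => by simp [ht]), eLpNorm_zero, enorm_eq_zero,
    sub_eq_zero] at h1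
  exact h1

theorem eq_of_forall_enorm_sub_le {v w : H} {K : ℝ≥0∞} (hK : K ≠ ∞)
    (h : ∀ ε : ℝ≥0∞, ε ≠ 0 → ‖v - w‖ₑ ≤ K * ε) : v = w := by
  have hlim : Tendsto (fun n : ℕ => K * (n : ℝ≥0∞)⁻¹) atTop (𝓝 (K * 0)) :=
    ENNReal.Tendsto.const_mul ENNReal.tendsto_inv_nat_nhds_zero (.inr hK)
  rw [mul_zero] at hlim
  have h0 : ‖v - w‖ₑ ≤ 0 := ge_of_tendsto' hlim fun n => h _ (by simp)
  simpa [sub_eq_zero] using h0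

theorem rep_repVector {g : X → ℂ} {x : H} (hg : MemLp g 2 (repMeasure Φ x)) (h : C(X, ℂ)) :
    Φ h (repVector Φ g x) = repVector Φ (fun t => h t * g t) x := by
  have hb (t : X) : ‖h t‖ ≤ ‖h‖ := h.norm_coe_le_norm t
  have hle (k : X → ℂ) : eLpNorm (fun t => h t * k t) 2 (repMeasure Φ x) ≤
      ENNReal.ofReal ‖h‖ * eLpNorm k 2 (repMeasure Φ x) :=
    eLpNorm_le_mul_eLpNorm_of_ae_le_mul (.of_forall fun t => by
      rw [norm_mul]
      exact mul_le_mul_of_nonneg_right (hb t) (norm_nonneg _)) 2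
  have hhg : MemLp (fun t => h t * g t) 2 (repMeasure Φ x) :=
    ⟨h.continuous.aestronglyMeasurable.mul hg.1,
      (hle g).trans_lt (ENNReal.mul_lt_top ENNReal.ofReal_lt_top hg.2)⟩
  refine eq_of_forall_enorm_sub_le (K := ‖Φ h‖ₑ + ENNReal.ofReal ‖h‖) (by simp) fun ε hε => ?_
  obtain ⟨f, hf⟩ := exists_continuousMap_eLpNorm_sub_le hg hε
  have e1 : Φ h (repVector Φ g x) - repVector Φ (fun t => h t * g t) x =
      Φ h (repVector Φ g x - Φ f x) - (repVector Φ (fun t => h t * g t) x - Φ (h * f) x) := by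
    rw [map_sub, map_mul, mul_apply_eq_comp]
    abel
  rw [e1]
  refine (enorm_sub_le).trans ?_
  rw [add_mul]
  refine add_le_add (((Φ h).le_opENorm _).trans ?_) ?_
  · rw [enorm_repVector_sub Φ hg]
    gcongr
  · rw [enorm_repVector_sub Φ hhg]
    have e2 : (fun t => h t * g t) - ⇑(h * f) = fun t => h t * (g - ⇑f) t := by
      ext t
      simp [mul_sub]
    rw [e2]
    exact (hle _).trans (by gcongr)

/-! ### Spectral projections from indicator functions -/

section Indicator

variable {B : Set X}

/-- The indicator function of `B`. -/
abbrev ind (B : Set X) : X → ℂ := B.indicator fun _ => 1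

theorem memLp_ind (hB : MeasurableSet B) (ν : Measure X) [IsFiniteMeasure ν] :
    MemLp (ind B) 2 ν :=
  memLp_indicator_const 2 hB 1 (.inr (measure_ne_top _ _))

theorem repVector_ind_add (hB : MeasurableSet B) (x y : H) :
    repVector Φ (ind B) (x + y) = repVector Φ (ind B) x + repVector Φ (ind B) y := by
  refine eq_of_forall_enorm_sub_le (K := 3) (by simp) fun ε hε => ?_
  -- The sum dominates all three measures, so a single continuous `f` approximates the indicator for
  -- the three vectors at once.
  set ν := repMeasure Φ x + repMeasure Φ y + repMeasure Φ (x + y)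
  obtain ⟨f, hf⟩ := exists_continuousMap_eLpNorm_sub_le (memLp_ind hB ν) hε
  have aux (z : H) (hz : repMeasure Φ z ≤ ν) : ‖repVector Φ (ind B) z - Φ f z‖ₑ ≤ ε := by
    rw [enorm_repVector_sub Φ (memLp_ind hB _)]
    exact (eLpNorm_mono_measure _ hz).trans hf
  have e : repVector Φ (ind B) (x + y) - (repVector Φ (ind B) x + repVector Φ (ind B) y) =
      (repVector Φ (ind B) (x + y) - Φ f (x + y)) - (repVector Φ (ind B) x - Φ f x) -
      (repVector Φ (ind B) y - Φ f y) := by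
    rw [map_add]
    abel
  rw [e]
  calc _ ≤ ε + ε + ε := by
        refine (enorm_sub_le).trans (add_le_add ((enorm_sub_le).trans (add_le_add
          (aux _ ?_) (aux _ ?_))) (aux _ ?_))
        · exact le_add_of_nonneg_left (Measure.zero_le _)
        · rw [show ν = repMeasure Φ x + (repMeasure Φ y + repMeasure Φ (x + y)) from add_assoc _ _ _]
          exact le_add_of_nonneg_right (Measure.zero_le _)
        · exact (le_add_of_nonneg_left (Measure.zero_le _)).trans
            (le_add_of_nonneg_right (Measure.zero_le _))
    _ = 3 * ε := by ring

theorem repVector_ind_smul (hB : MeasurableSet B) (c : ℂ) (x : H) :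
    repVector Φ (ind B) (c • x) = c • repVector Φ (ind B) x := by
  refine eq_of_forall_enorm_sub_le (K := 1 + ‖c‖ₑ) (by simp) fun ε hε => ?_
  set ν := repMeasure Φ x + repMeasure Φ (c • x)
  obtain ⟨f, hf⟩ := exists_continuousMap_eLpNorm_sub_le (memLp_ind hB ν) hε
  have aux (z : H) (hz : repMeasure Φ z ≤ ν) : ‖repVector Φ (ind B) z - Φ f z‖ₑ ≤ ε := by
    rw [enorm_repVector_sub Φ (memLp_ind hB _)]
    exact (eLpNorm_mono_measure _ hz).trans hf
  have e : repVector Φ (ind B) (c • x) - c • repVector Φ (ind B) x =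
      (repVector Φ (ind B) (c • x) - Φ f (c • x)) - c • (repVector Φ (ind B) x - Φ f x) := by
    rw [map_smul, smul_sub]
    abel
  rw [e, add_mul, one_mul]
  refine (enorm_sub_le).trans (add_le_add (aux _ ?_) ?_)
  · exact le_add_of_nonneg_left (Measure.zero_le _)
  · rw [enorm_smul]
    gcongr
    exact aux _ (le_add_of_nonneg_right (Measure.zero_le _))

theorem real_repMeasure_univ (x : H) : (repMeasure Φ x).real univ = ‖x‖ ^ 2 := by
  have := norm_rep_apply_sq Φ 1 x
  simpa using this.symm

theorem norm_repVector_ind_sub_smul_sq (hB : MeasurableSet B) (x : H) (c : ℂ) :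
    ‖repVector Φ (ind B) x - c • x‖ ^ 2 = ‖1 - c‖ ^ 2 * (repMeasure Φ x).real B +
      ‖c‖ ^ 2 * (repMeasure Φ x).real Bᶜ := by
  have h := norm_repVector_sub_sq Φ (memLp_ind hB (repMeasure Φ x)) (algebraMap ℂ _ c)
  rw [AlgHomClass.commutes, ContinuousLinearMap.algebraMap_apply] at h
  rw [h]
  have e (t : X) : ‖ind B t - (algebraMap ℂ C(X, ℂ) c) t‖ ^ 2 =
      B.indicator (fun _ => ‖1 - c‖ ^ 2) t + Bᶜ.indicator (fun _ => ‖c‖ ^ 2) t := by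
    by_cases ht : t ∈ B <;> simp [ind, ht]
  simp_rw [e]
  rw [integral_add ((integrable_const _).indicator hB) ((integrable_const _).indicator hB.compl),
    integral_indicator_const _ hB, integral_indicator_const _ hB.compl]
  simp [mul_comm]

theorem norm_repVector_ind_sq (hB : MeasurableSet B) (x : H) :
    ‖repVector Φ (ind B) x‖ ^ 2 = (repMeasure Φ x).real B := by
  simpa using norm_repVector_ind_sub_smul_sq Φ hB x 0

/-- The distances from `1_B(Φ) x` to `c • x` for `c = 0, 1, i` determine the real and imaginary
parts of the inner product. -/
theorem inner_repVector_ind (hB : MeasurableSet B) (x : H) :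
    ⟪repVector Φ (ind B) x, x⟫_ℂ = ((repMeasure Φ x).real B : ℂ) := by
  have h0 := norm_repVector_ind_sq Φ hB x
  have h1 := norm_repVector_ind_sub_smul_sq Φ hB x 1
  have hI := norm_repVector_ind_sub_smul_sq Φ hB x Complex.I
  have hc : (repMeasure Φ x).real B + (repMeasure Φ x).real Bᶜ = ‖x‖ ^ 2 := by
    rw [← real_repMeasure_univ Φ x, measureReal_add_measureReal_compl hB]
  have hn : ‖1 - Complex.I‖ ^ 2 = 2 := by
    rw [← Complex.normSq_eq_norm_sq, Complex.normSq_apply]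
    norm_num
  rw [norm_sub_sq (𝕜 := ℂ), h0, norm_smul, inner_smul_right] at h1 hI
  rw [hn] at hI
  simp only [one_mul, sub_self, norm_zero, norm_one, Complex.norm_I, RCLike.re_to_complex,
    Complex.I_mul_re] at h1 hI
  apply Complex.ext
  · rw [Complex.ofReal_re]
    linarith
  · rw [Complex.ofReal_im]
    linarith

/-- The spectral projection `1_B(Φ)`. -/
def repProj (B : Set X) (hB : MeasurableSet B) : H →L[ℂ] H :=
  LinearMap.mkContinuous
    { toFun := repVector Φ (ind B)
      map_add' := repVector_ind_add Φ hB
      map_smul' := repVector_ind_smul Φ hB } 1 fun x => by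
    refine abs_le_of_sq_le_sq' ?_ (by positivity) |>.2
    rw [one_mul, ← real_repMeasure_univ Φ x]
    exact (norm_repVector_ind_sq Φ hB x).le.trans (measureReal_mono (subset_univ _))

theorem repProj_apply (hB : MeasurableSet B) (x : H) :
    repProj Φ B hB x = repVector Φ (ind B) x := rfl

theorem inner_repProj (hB : MeasurableSet B) (x : H) :
    ⟪x, repProj Φ B hB x⟫_ℂ = ((repMeasure Φ x).real B : ℂ) := by
  rw [← inner_conj_symm, repProj_apply, inner_repVector_ind Φ hB, Complex.conj_ofReal]

theorem ext_inner_apply_self {S T : H →L[ℂ] H} (h : ∀ x, ⟪x, S x⟫_ℂ = ⟪x, T x⟫_ℂ) : S = T := by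
  have := (ext_inner_map (S : H →ₗ[ℂ] H) (T : H →ₗ[ℂ] H)).1 fun x => by
    rw [← inner_conj_symm, ← inner_conj_symm _ x]
    exact congrArg _ (h x)
  exact ContinuousLinearMap.coe_injective this

/-- The form `⟪x, P x⟫` is real, so `P` is self-adjoint; it equals `‖P x‖ ^ 2`, so `P * P` and `P`
have the same form. -/
theorem isStarProjection_repProj (hB : MeasurableSet B) : IsStarProjection (repProj Φ B hB) := by
  have hs : IsSelfAdjoint (repProj Φ B hB) := by
    refine ext_inner_apply_self fun x => ?_
    rw [← inner_star_apply, star_star, repProj_apply, inner_repVector_ind Φ hB,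
      ← repProj_apply Φ hB, inner_repProj]
  refine ⟨ext_inner_apply_self fun x => ?_, hs⟩
  rw [mul_apply_eq_comp, ← inner_selfAdjoint_apply_left hs, inner_repProj,
    inner_self_eq_norm_sq_to_K (𝕜 := ℂ), repProj_apply, ← norm_repVector_ind_sq Φ hB x]
  push_cast
  rfl

theorem repProj_univ : repProj Φ univ .univ = 1 := by
  refine ext_inner_apply_self fun x => ?_
  rw [inner_repProj, real_repMeasure_univ, one_apply_eq_self,
    inner_self_eq_norm_sq_to_K (𝕜 := ℂ)]
  push_cast
  rfl

end Indicator

end Representation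

/-! ### Resolvents of self-adjoint operators -/

section Resolvent

set_option linter.unusedSectionVars false

/-- A densely defined symmetric operator that contains its adjoint. -/
structure IsMaximalSymmetric (A : H →ₗ.[ℂ] H) : Prop where
  dense : Dense (A.domain : Set H)
  symm : A.IsFormalAdjoint A
  maximal : ∀ y z : H, (∀ x : A.domain, ⟪A x, y⟫_ℂ = ⟪(x : H), z⟫_ℂ) →
    ∃ h : y ∈ A.domain, A ⟨y, h⟩ = z

variable {A : H →ₗ.[ℂ] H}

theorem isMaximalSymmetric_of_isSelfAdjoint (hA : IsSelfAdjoint A) : IsMaximalSymmetric A := by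
  have hd := hA.dense_domain
  have hA' := LinearPMap.isSelfAdjoint_def.1 hA
  refine ⟨hd, ?_, fun y z h => ?_⟩
  · have := LinearPMap.adjoint_isFormalAdjoint hd
    rwa [hA'] at this
  · have hg : (y, z) ∈ A.graph := by
      rw [← hA', LinearPMap.adjoint_graph_eq_graph_adjoint hd, Submodule.mem_adjoint_iff]
      intro a c hac
      obtain ⟨w, rfl, rfl⟩ := (LinearPMap.mem_graph_iff A).1 hac
      rw [h w, sub_self]
    obtain ⟨w, rfl, rfl⟩ := (LinearPMap.mem_graph_iff A).1 hg
    exact ⟨w.2, rfl⟩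

theorem IsMaximalSymmetric.perturb (hA : IsMaximalSymmetric A) {W : H →L[ℂ] H}
    (hW : IsSelfAdjoint W) : IsMaximalSymmetric (perturb A W) := by
  have happ (x : (TraceMonotonicity.perturb A W).domain) :
      TraceMonotonicity.perturb A W x = W x + A x := rfl
  refine ⟨hA.dense, fun x y => ?_, fun y z h => ?_⟩
  · rw [happ, happ, inner_add_left, inner_add_right, inner_selfAdjoint_apply_left hW]
    congr 1
    exact hA.symm x y
  · obtain ⟨hy, hz⟩ := hA.maximal y (z - W y) fun x => by
      have : ⟪W x + A x, y⟫_ℂ = ⟪(x : H), z⟫_ℂ := h x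
      rw [inner_add_left, inner_selfAdjoint_apply_left hW] at this
      rw [inner_sub_right, ← this, add_sub_cancel_left]
    exact ⟨hy, by rw [happ]; exact (congrArg (W y + ·) hz).trans (add_sub_cancel _ _)⟩

/-- The cross term has no real part, `⟪A x, x⟫` being real and `ε` imaginary. The conditions on `ε`
cover `i` and `-i` together. -/
theorem IsMaximalSymmetric.norm_add_smul_sq (hA : IsMaximalSymmetric A) {ε : ℂ}
    (hε : starRingEnd ℂ ε = -ε) (hε' : ‖ε‖ = 1) (x : A.domain) :
    ‖A x + ε • (x : H)‖ ^ 2 = ‖A x‖ ^ 2 + ‖(x : H)‖ ^ 2 := by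
  have him : (⟪A x, (x : H)⟫_ℂ).im = 0 := by
    rw [← Complex.conj_eq_iff_im, inner_conj_symm, hA.symm x x]
  have hre : ε.re = 0 := by
    have := congrArg Complex.re hε
    simp at this
    linarith
  rw [norm_add_sq (𝕜 := ℂ), inner_smul_right, norm_smul, hε', one_mul]
  simp [him, hre]

theorem IsMaximalSymmetric.isClosed_graph (hA : IsMaximalSymmetric A) :
    IsClosed (A.graph : Set (H × H)) := by
  have : (A.graph : Set (H × H)) =
      ⋂ x : A.domain, {p : H × H | ⟪A x, p.1⟫_ℂ = ⟪(x : H), p.2⟫_ℂ} := by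
    ext p
    simp only [SetLike.mem_coe, mem_iInter, mem_ofPred_eq]
    constructor
    · intro hp x
      obtain ⟨w, h1, h2⟩ := (LinearPMap.mem_graph_iff A).1 hp
      rw [← h1, ← h2, hA.symm x w]
    · intro hp
      obtain ⟨h, h'⟩ := hA.maximal p.1 p.2 hp
      exact (LinearPMap.mem_graph_iff A).2 ⟨⟨p.1, h⟩, rfl, h'⟩
  rw [this]
  exact isClosed_iInter fun x => isClosed_eq (by fun_prop) (by fun_prop)

/-- The range is closed, since the map is bounded below on the complete graph. A vector `z`
orthogonal to it lies in the domain with `A z = ε z`, and the norm identity for `-ε` forces `z = 0`.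
-/
theorem IsMaximalSymmetric.exists_add_smul_eq (hA : IsMaximalSymmetric A) {ε : ℂ}
    (hε : starRingEnd ℂ ε = -ε) (hε' : ‖ε‖ = 1) (y : H) :
    ∃ x : A.domain, A x + ε • (x : H) = y := by
  have : CompleteSpace A.graph := hA.isClosed_graph.completeSpace_coe
  let T : A.graph →L[ℂ] H :=
    (ContinuousLinearMap.snd ℂ H H + ε • ContinuousLinearMap.fst ℂ H H).comp A.graph.subtypeL
  have hT (x : A.domain) : T ⟨(x, A x), A.mem_graph x⟩ = A x + ε • (x : H) := rfl
  have hcl : IsClosed (LinearMap.range T.toLinearMap : Set H) := by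
    have : AntilipschitzWith 1 T := by
      refine ContinuousLinearMap.antilipschitz_of_bound T fun p => ?_
      obtain ⟨⟨u, v⟩, hp⟩ := p
      obtain ⟨w, h1, h2⟩ := (LinearPMap.mem_graph_iff A).1 hp
      simp only at h1 h2
      subst h1 h2
      have h3 := hA.norm_add_smul_sq hε hε' w
      rw [NNReal.coe_one, one_mul, hT]
      change max ‖(w : H)‖ ‖A w‖ ≤ _
      refine max_le ?_ ?_ <;>
      · refine abs_le_of_sq_le_sq' ?_ (by positivity) |>.2
        rw [h3]
        nlinarith [sq_nonneg ‖A w‖, sq_nonneg ‖(w : H)‖]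
    have h := this.isClosed_range T.uniformContinuous
    exact h
  have htop : LinearMap.range T.toLinearMap = ⊤ := by
    have : CompleteSpace (LinearMap.range T.toLinearMap) := hcl.completeSpace_coe
    rw [← Submodule.orthogonal_eq_bot_iff, Submodule.eq_bot_iff]
    intro z hz
    rw [Submodule.mem_orthogonal] at hz
    obtain ⟨h, h'⟩ := hA.maximal z (ε • z) fun x => by
      have := hz _ ⟨⟨(x, A x), A.mem_graph x⟩, rfl⟩
      change ⟪A x + ε • (x : H), z⟫_ℂ = 0 at this
      rw [inner_add_left, inner_smul_left, hε] at this
      rw [inner_smul_right]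
      linear_combination this
    have h1 := hA.norm_add_smul_sq (ε := -ε) (by rw [map_neg, hε]) (by rw [norm_neg, hε']) ⟨z, h⟩
    rw [h', neg_smul, add_neg_cancel, norm_zero] at h1
    have h2 : ‖z‖ ^ 2 = 0 := by nlinarith [sq_nonneg ‖z‖, sq_nonneg ‖ε • z‖]
    simpa using h2
  have hy : y ∈ LinearMap.range T.toLinearMap := htop ▸ Submodule.mem_top
  obtain ⟨⟨⟨u, v⟩, hp⟩, rfl⟩ := hy
  obtain ⟨w, h1, h2⟩ := (LinearPMap.mem_graph_iff A).1 hp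
  simp only at h1 h2
  subst h1 h2
  exact ⟨w, rfl⟩

theorem IsMaximalSymmetric.exists_resolvent (hA : IsMaximalSymmetric A) {ε : ℂ}
    (hε : starRingEnd ℂ ε = -ε) (hε' : ‖ε‖ = 1) :
    ∃ R : H →L[ℂ] H, (∀ y, ∃ h : R y ∈ A.domain, A ⟨R y, h⟩ + ε • R y = y) ∧
      ∀ x : A.domain, R (A x + ε • (x : H)) = x := by
  let T : A.domain →ₗ[ℂ] H := A.toFun + ε • A.domain.subtype
  have hT (x : A.domain) : T x = A x + ε • (x : H) := rfl
  have hle (x : A.domain) : ‖(x : H)‖ ≤ ‖T x‖ := by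
    refine abs_le_of_sq_le_sq' ?_ (by positivity) |>.2
    rw [hT, hA.norm_add_smul_sq hε hε' x]
    nlinarith [sq_nonneg ‖A x‖]
  have hinj : Function.Injective T := by
    rw [injective_iff_map_eq_zero]
    intro x hx
    have := hle x
    rw [hx, norm_zero, norm_le_zero_iff] at this
    exact Subtype.ext this
  let e : A.domain ≃ₗ[ℂ] H := LinearEquiv.ofBijective T ⟨hinj, hA.exists_add_smul_eq hε hε'⟩
  have he (y : H) : T (e.symm y) = y := e.apply_symm_apply y
  let R : H →L[ℂ] H := (A.domain.subtype ∘ₗ e.symm.toLinearMap).mkContinuous 1 fun y => by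
    rw [one_mul]
    refine (hle (e.symm y)).trans_eq ?_
    rw [he]
  have hR (y : H) : R y = e.symm y := rfl
  refine ⟨R, fun y => ⟨(e.symm y).2, he y⟩, fun x => ?_⟩
  rw [hR, ← hT]
  exact congrArg Subtype.val (e.symm_apply_apply x)

/-- The resolvent at `-i` of a self-adjoint operator is normal. -/
theorem IsMaximalSymmetric.exists_normal_resolvent (hA : IsMaximalSymmetric A) :
    ∃ R : H →L[ℂ] H, (∀ y, ∃ h : R y ∈ A.domain, A ⟨R y, h⟩ + Complex.I • R y = y) ∧
      (∀ x : A.domain, R (A x + Complex.I • (x : H)) = x) ∧ IsStarNormal R ∧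
      R - star R = -(2 * Complex.I) • (star R * R) := by
  obtain ⟨R, h1, h2⟩ := hA.exists_resolvent (ε := Complex.I) (by simp) (by simp)
  obtain ⟨R', h1', h2'⟩ := hA.exists_resolvent (ε := -Complex.I) (by simp) (by simp)
  -- The adjoint of `(A + i)⁻¹` is `(A - i)⁻¹`. The resolvent identity written in both orders then
  -- shows that the two commute.
  have hstar : star R = R' := by
    refine ContinuousLinearMap.ext fun z => ext_inner_left ℂ fun y => ?_
    obtain ⟨h, e⟩ := h1 y
    obtain ⟨h', e'⟩ := h1' z
    have := hA.symm ⟨R y, h⟩ ⟨R' z, h'⟩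
    rw [← inner_star_apply, star_star]
    conv_lhs => rw [← e']
    conv_rhs => rw [← e]
    rw [inner_add_left, inner_add_right, this, inner_smul_left, inner_smul_right]
    simp
  have r1 : R - R' = -(2 * Complex.I) • (R' * R) := by
    ext y
    obtain ⟨h, e⟩ := h1 y
    have e' : R' (A ⟨R y, h⟩ + -Complex.I • R y) = R y := h2' ⟨R y, h⟩
    rw [eq_sub_of_add_eq e, map_add, map_sub, map_smul, map_smul] at e'
    simp only [sub_apply, smul_apply, mul_apply_eq_comp]
    calc R y - R' y
        = (R' y - Complex.I • R' (R y) + -Complex.I • R' (R y)) - R' y := by rw [e']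
      _ = _ := by module
  have r2 : R - R' = -(2 * Complex.I) • (R * R') := by
    ext y
    obtain ⟨h, e⟩ := h1' y
    have e' : R (A ⟨R' y, h⟩ + Complex.I • R' y) = R' y := h2 ⟨R' y, h⟩
    rw [eq_sub_of_add_eq e, map_add, map_sub, map_smul, map_smul] at e'
    simp only [sub_apply, smul_apply, mul_apply_eq_comp]
    calc R y - R' y
        = R y - (R y - -Complex.I • R (R' y) + Complex.I • R (R' y)) := by rw [e']
      _ = _ := by module
  have hcomm : R' * R = R * R' := by
    have h0 : -(2 * Complex.I) ≠ 0 := by simp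
    exact smul_right_injective _ h0 (r1.symm.trans r2)
  refine ⟨R, h1, h2, ⟨?_⟩, ?_⟩
  · rw [hstar]
    exact hcomm
  · rw [hstar, r1]

end Resolvent

/-! ### The spectral theorem -/

section SpectralTheorem

set_option linter.unusedSectionVars false

/-! ### Countable additivity, push-forward to `ℝ`, and change of density -/

section PushForward

variable {X : Type*} [MetricSpace X] [CompactSpace X] [MeasurableSpace X] [BorelSpace X]
variable (Φ : C(X, ℂ) →⋆ₐ[ℂ] (H →L[ℂ] H))

/-- The squared norm of each remainder is the measure of the part of the union not yet covered, so
strong convergence follows from additivity of a scalar measure. -/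
theorem hasSum_repProj {B : ℕ → Set X} (hB : ∀ n, MeasurableSet (B n))
    (hd : Pairwise (Function.onFun Disjoint B)) (x : H) :
    HasSum (fun n => repProj Φ (B n) (hB n) x) (repProj Φ (⋃ n, B n) (.iUnion hB) x) := by
  set ν := repMeasure Φ x
  have hU : MeasurableSet (⋃ n, B n) := .iUnion hB
  have hs (s : Finset ℕ) : MeasurableSet (⋃ n ∈ s, B n) := s.measurableSet_biUnion fun n _ => hB n
  have hrest (ρ : Measure X) [IsFiniteMeasure ρ] (s : Finset ℕ) :
      ρ.real ((⋃ n, B n) \ ⋃ n ∈ s, B n) = ρ.real (⋃ n, B n) - ∑ n ∈ s, ρ.real (B n) := by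
    rw [measureReal_sdiff (iUnion₂_subset fun n _ => subset_iUnion B n) (hs s),
      measureReal_biUnion_finset (fun m _ n _ hmn => hd hmn) fun n _ => hB n]
  have hsub (s : Finset ℕ) : repProj Φ (⋃ n, B n) hU - ∑ n ∈ s, repProj Φ (B n) (hB n) =
      repProj Φ ((⋃ n, B n) \ ⋃ n ∈ s, B n) (hU.diff (hs s)) := by
    refine ext_inner_apply_self fun y => ?_
    rw [inner_repProj, hrest, sub_apply, inner_sub_right, inner_repProj, sum_apply, inner_sum]
    simp only [inner_repProj]
    push_cast
    rfl
  have hν : HasSum (fun n => ν.real (B n)) (ν.real (⋃ n, B n)) := by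
    have hm := measure_iUnion (μ := ν) hd hB
    have h := ENNReal.hasSum_toReal (f := fun n => ν (B n)) (by rw [← hm]; finiteness)
    rw [← ENNReal.tsum_toReal_eq fun n => by finiteness, ← hm] at h
    exact h
  rw [HasSum, tendsto_iff_norm_sub_tendsto_zero]
  have hnorm (s : Finset ℕ) : ‖∑ n ∈ s, repProj Φ (B n) (hB n) x - repProj Φ (⋃ n, B n) hU x‖ =
      √(ν.real (⋃ n, B n) - ∑ n ∈ s, ν.real (B n)) := by
    have h := congrArg (fun T : H →L[ℂ] H => T x) (hsub s)
    simp only [sub_apply, sum_apply] at h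
    rw [norm_sub_rev, h, repProj_apply, eq_comm, Real.sqrt_eq_iff_mul_self_eq, ← sq,
      norm_repVector_ind_sq Φ (hU.diff (hs s)), hrest]
    · rw [← hrest]
      exact measureReal_nonneg
    · exact norm_nonneg _
  simp_rw [hnorm]
  have := (Real.continuous_sqrt.tendsto _).comp (hν.const_sub (ν.real (⋃ n, B n)))
  rw [sub_self, Real.sqrt_zero] at this
  exact this

open scoped Classical in
/-- The projection-valued measure on `ℝ` obtained by pushing forward along `φ`. -/
def repPVM {φ : X → ℝ} (hφ : Measurable φ) : ProjectionValuedMeasure H where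
  proj B := if h : MeasurableSet B then repProj Φ (φ ⁻¹' B) (hφ h) else 0
  isStarProjection B hB := by
    rw [dif_pos hB]
    exact isStarProjection_repProj Φ _
  proj_univ := by
    rw [dif_pos .univ]
    exact repProj_univ Φ
  hasSum_iUnion B hB hd x := by
    rw [dif_pos (MeasurableSet.iUnion hB)]
    simp only [dif_pos (hB _)]
    have := hasSum_repProj Φ (fun n => hφ (hB n)) (fun m n hmn => (hd hmn).preimage φ) x
    simpa only [preimage_iUnion] using this

theorem repPVM_measure {φ : X → ℝ} (hφ : Measurable φ) (x : H) :
    (repPVM Φ hφ).measure x = (repMeasure Φ x).map φ := by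
  ext B hB
  rw [ProjectionValuedMeasure.measure_apply _ _ hB, Measure.map_apply hφ hB]
  simp only [repPVM, dif_pos hB, inner_repProj]
  rw [RCLike.re_to_complex, Complex.ofReal_re, ofReal_measureReal]

/-- Both measures integrate `u` to `⟪y, Φ (h* u h) y⟫`. For `Φ h` the resolvent, this describes the
measures of vectors in the domain of `A`. -/
theorem repMeasure_rep_apply (h : C(X, ℂ)) (y : H) :
    repMeasure Φ (Φ h y) =
      (repMeasure Φ y).withDensity fun t => ENNReal.ofReal (‖h t‖ ^ 2) := by
  have hm : Measurable fun t => (‖h t‖ ^ 2).toNNReal := by fun_prop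
  have hfin : IsFiniteMeasure
      ((repMeasure Φ y).withDensity fun t => ENNReal.ofReal (‖h t‖ ^ 2)) := by
    refine isFiniteMeasure_withDensity_ofReal ?_
    have : Continuous fun t => ‖h t‖ ^ 2 := by fun_prop
    exact (this.integrable_of_hasCompactSupport
      (HasCompactSupport.of_compactSpace _)).hasFiniteIntegral
  refine ext_of_forall_integral_eq_of_IsFiniteMeasure fun u => ?_
  have h1 := inner_rep_apply Φ (Φ h y) (toComplexMap u.toContinuousMap)
  have h2 := inner_rep_apply Φ y (star h * toComplexMap u.toContinuousMap * h)
  have h3 : ⟪Φ h y, Φ (toComplexMap u.toContinuousMap) (Φ h y)⟫_ℂ =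
      ⟪y, Φ (star h * toComplexMap u.toContinuousMap * h) y⟫_ℂ := by
    rw [map_mul, map_mul, map_star, mul_apply_eq_comp, mul_apply_eq_comp,
      ← inner_star_apply (star (Φ h)), star_star]
  rw [h1, h2] at h3
  have e (t : X) : (star h * toComplexMap u.toContinuousMap * h) t =
      ((‖h t‖ ^ 2 * u t : ℝ) : ℂ) := by
    have := Complex.conj_mul' (h t)
    simp only [ContinuousMap.mul_apply, ContinuousMap.star_apply, RCLike.star_def, toComplexMap,
      ContinuousMap.coe_mk]
    push_cast
    rw [← this]
    simp only [BoundedContinuousFunction.coe_toContinuousMap]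
    ring
  simp_rw [e] at h3
  rw [integral_complex_ofReal] at h3
  have h4 : ∫ t, u t ∂repMeasure Φ (Φ h y) = ∫ t, ‖h t‖ ^ 2 * u t ∂repMeasure Φ y := by
    have : ∫ t, (toComplexMap u.toContinuousMap) t ∂repMeasure Φ (Φ h y) =
      ((∫ t, u t ∂repMeasure Φ (Φ h y) : ℝ) : ℂ) := integral_complex_ofReal
    rw [this] at h3
    exact_mod_cast h3
  rw [h4]
  have h5 := integral_withDensity_eq_integral_smul (μ := repMeasure Φ y) hm u
  refine Eq.trans ?_ h5.symm
  refine integral_congr_ae (.of_forall fun t => ?_)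
  simp only [NNReal.smul_def, smul_eq_mul]
  rw [Real.coe_toNNReal _ (by positivity)]

end PushForward

variable {A : H →ₗ.[ℂ] H}

/-- A point `t` of the spectrum of `R = (A + i)⁻¹` corresponds to `λ + i = 1 / t`, so the spectral
measure of `A` is that of `R` pushed forward along `t ↦ Re (1 / t)`. -/
theorem IsMaximalSymmetric.exists_isSpectralMeasureOf (hA : IsMaximalSymmetric A) :
    ∃ E : ProjectionValuedMeasure H, E.IsSpectralMeasureOf A := by
  obtain ⟨R, hR, hR', hnormal, hrel⟩ := hA.exists_normal_resolvent
  let X := spectrum ℂ R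
  let Φ : C(X, ℂ) →⋆ₐ[ℂ] (H →L[ℂ] H) := cfcHom hnormal
  let z : C(X, ℂ) := (ContinuousMap.id ℂ).restrict (spectrum ℂ R)
  have hz : Φ z = R := cfcHom_id hnormal
  have hzt (t : X) : z t = t := rfl
  let φ : X → ℝ := fun t => ((t : ℂ)⁻¹).re
  have hφ : Measurable φ := by fun_prop
  -- the spectrum of `R` lies on a circle
  have hcirc (t : X) : (t : ℂ) ≠ 0 → ((t : ℂ)⁻¹).im = 1 := by
    have h0 : Φ (z - star z + (2 * Complex.I) • (star z * z)) = Φ 0 := by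
      rw [map_add, map_sub, map_smul, map_mul, map_star, hz, hrel, map_zero, neg_smul,
        neg_add_cancel]
    have h1 := congrArg (fun f : C(X, ℂ) => (f t).im) (cfcHom_injective hnormal h0)
    simp [hzt] at h1
    intro ht
    have hn : Complex.normSq (t : ℂ) ≠ 0 := by simpa using ht
    rw [Complex.inv_im, div_eq_one_iff_eq hn, Complex.normSq_apply]
    linarith
  have hinj : Function.Injective R := by
    rw [injective_iff_map_eq_zero]
    intro y hy
    obtain ⟨h, e⟩ := hR y
    have : (⟨R y, h⟩ : A.domain) = 0 := Subtype.ext hy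
    rw [this, hy, LinearPMap.map_zero, smul_zero, add_zero] at e
    exact e.symm
  -- The point `t = 0` stands for `λ = ∞`. Its spectral projection is annihilated by the injective
  -- `R`, so it carries no mass.
  have hzero (x : H) : ∀ᵐ t : X ∂repMeasure Φ x, (t : ℂ) ≠ 0 := by
    let B : Set X := {t | (t : ℂ) = 0}
    have hB : MeasurableSet B := (isClosed_eq (by fun_prop) (by fun_prop)).measurableSet
    have h1 := rep_repVector Φ (memLp_ind hB (repMeasure Φ x)) z
    have h2 : (fun t => z t * ind B t) = ⇑(0 : C(X, ℂ)) := by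
      ext t
      by_cases ht : t ∈ B
      · have : (t : ℂ) = 0 := ht
        simp [hzt, this]
      · simp [ind, ht]
    rw [h2, repVector_eq_of_ae_eq Φ (ae_eq_refl _), map_zero, hz, zero_apply] at h1
    have h3 : repVector Φ (ind B) x = 0 := hinj (h1.trans (map_zero R).symm)
    have h4 := norm_repVector_ind_sq Φ hB x
    rw [h3, norm_zero, zero_pow two_ne_zero, eq_comm, measureReal_eq_zero_iff] at h4
    rw [ae_iff]
    simpa [B] using h4
  have hmeas (y : H) := repMeasure_rep_apply Φ z y
  rw [hz] at hmeas
  have hwd (y : H) : repMeasure Φ (R y) =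
      (repMeasure Φ y).withDensity fun t : X => ((‖(t : ℂ)‖ ^ 2).toNNReal : ℝ≥0∞) := hmeas y
  have hmnn : Measurable fun t : X => (‖(t : ℂ)‖ ^ 2).toNNReal := by fun_prop
  have hdom (x : A.domain) : ∃ y, (x : H) = R y ∧ A x = y - Complex.I • (x : H) :=
    ⟨_, (hR' x).symm, by rw [add_sub_cancel_right]⟩
  refine ⟨repPVM Φ hφ, ⟨fun x => ?_, fun x => ?_⟩⟩
  · rw [repPVM_measure, integrable_map_measure (by fun_prop) hφ.aemeasurable]
    constructor
    · intro hx
      obtain ⟨y, hy, -⟩ := hdom ⟨x, hx⟩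
      simp only at hy
      rw [hy, hwd, integrable_withDensity_iff_integrable_smul hmnn]
      refine (integrable_const (1 : ℝ)).mono' (by fun_prop) (.of_forall fun t => ?_)
      simp only [Function.comp_apply, NNReal.smul_def, smul_eq_mul, φ]
      rw [Real.coe_toNNReal _ (by positivity), Real.norm_of_nonneg (by positivity), ← mul_pow]
      have h1 : ‖(t : ℂ)‖ * |((t : ℂ)⁻¹).re| ≤ 1 := by
        refine (mul_le_mul_of_nonneg_left (Complex.abs_re_le_norm _) (norm_nonneg _)).trans ?_
        rw [norm_inv]
        exact mul_inv_le_one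
      rw [← sq_abs, abs_mul, abs_norm]
      exact pow_le_one₀ (by positivity) h1
    · intro hx
      -- Almost everywhere `|1 / t|² = λ² + 1`. Hence the vector obtained by applying `1 / t` to `x`
      -- exists, and `R` maps it to `x`, so `x` is in the domain.
      have hg : MemLp (fun t : X => (t : ℂ)⁻¹) 2 (repMeasure Φ x) := by
        have hms : AEStronglyMeasurable (fun t : X => (t : ℂ)⁻¹) (repMeasure Φ x) :=
          (Measurable.aestronglyMeasurable (by fun_prop))
        rw [memLp_two_iff_integrable_sq_norm hms]
        refine (hx.add (integrable_const (1 : ℝ))).mono' (by fun_prop) ?_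
        filter_upwards [hzero x] with t ht
        simp only [Function.comp_apply, Pi.add_apply, φ]
        rw [Real.norm_of_nonneg (by positivity), ← Complex.normSq_eq_norm_sq, Complex.normSq_apply,
          hcirc t ht]
        exact le_of_eq (by ring)
      have h1 := rep_repVector Φ hg z
      have h2 : (fun t : X => z t * (t : ℂ)⁻¹) =ᵐ[repMeasure Φ x] ⇑(1 : C(X, ℂ)) := by
        filter_upwards [hzero x] with t ht
        simp [hzt, ht]
      rw [repVector_eq_of_ae_eq Φ h2, map_one, hz, one_apply_eq_self] at h1
      rw [← h1]
      exact (hR _).1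
  · obtain ⟨y, hy, hAx⟩ := hdom x
    have him : (⟪(x : H), A x⟫_ℂ).im = 0 := by
      rw [← Complex.conj_eq_iff_im, inner_conj_symm, hA.symm x x]
    have h1 : (⟪(x : H), A x⟫_ℂ).re = (⟪y, R y⟫_ℂ).re := by
      rw [hAx, inner_sub_right, inner_smul_right, inner_self_eq_norm_sq_to_K (𝕜 := ℂ), hy]
      have := inner_re_symm (𝕜 := ℂ) (R y) y
      simpa [← Complex.ofReal_pow] using this
    -- Since `x = R y`, its measure has density `|t|²` relative to that of `y`, and `|t|² Re (1 / t)
    -- = Re t`.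
    have h2 : ∫ l : ℝ, l ∂(repPVM Φ hφ).measure (x : H) = (⟪y, R y⟫_ℂ).re := by
      rw [repPVM_measure, integral_map hφ.aemeasurable (by fun_prop), hy, hwd,
        integral_withDensity_eq_integral_smul hmnn]
      have h3 := inner_rep_apply Φ y z
      rw [hz] at h3
      have hzi : Integrable z (repMeasure Φ y) :=
        z.continuous.integrable_of_hasCompactSupport (HasCompactSupport.of_compactSpace _)
      rw [h3, ← RCLike.re_to_complex, ← integral_re hzi]
      refine integral_congr_ae (.of_forall fun t => ?_)
      simp only [NNReal.smul_def, smul_eq_mul, φ, hzt, RCLike.re_to_complex]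
      rw [Real.coe_toNNReal _ (by positivity), Complex.inv_re, ← Complex.normSq_eq_norm_sq]
      by_cases ht : (t : ℂ) = 0
      · simp [ht]
      · have hn : Complex.normSq (t : ℂ) ≠ 0 := by simpa using ht
        field_simp
    rw [h2]
    apply Complex.ext
    · rw [h1, Complex.ofReal_re]
    · rw [him, Complex.ofReal_im]

end SpectralTheorem

/-! ### Concave families of trace class perturbations -/

section Concave

set_option linter.unusedSectionVars false

variable {F F' F'' : ℝ → H →L[ℂ] H} {s t s₁ s₂ : ℝ}

theorem hasDerivAt_of_hasTraceNormDerivAt {D : H →L[ℂ] H} (h : HasTraceNormDerivAt F D s) :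
    HasDerivAt F D s := by
  rw [hasDerivAt_iff_tendsto_slope_zero, tendsto_iff_norm_sub_tendsto_zero]
  have h1 : Tendsto (fun r : ℝ => ENNReal.ofReal ‖r⁻¹ • (F (s + r) - F s) - D‖) (𝓝[≠] 0) (𝓝 0) :=
    tendsto_of_tendsto_of_tendsto_of_le_of_le tendsto_const_nhds h.2 (fun _ => zero_le)
      fun _ => ofReal_norm_le_traceNorm _
  have h2 := (ENNReal.tendsto_toReal ENNReal.zero_ne_top).comp h1
  simpa only [Function.comp_def, ENNReal.toReal_ofReal (norm_nonneg _), ENNReal.toReal_zero]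
    using h2

theorem isSelfAdjoint_of_hasDerivAt {D : H →L[ℂ] H} (h : HasDerivAt F D s)
    (hF : ∀ᶠ r in 𝓝 s, IsSelfAdjoint (F r)) : IsSelfAdjoint D := by
  have h1 : HasDerivAt F (star D) s :=
    h.star.congr_of_eventuallyEq (hF.mono fun r hr => hr.star_eq.symm)
  exact h1.unique h

theorem hasDerivAt_re_inner {D : H →L[ℂ] H} (h : HasDerivAt F D s) (x : H) :
    HasDerivAt (fun r => RCLike.re ⟪x, F r x⟫_ℂ) (RCLike.re ⟪x, D x⟫_ℂ) s := by
  let L : (H →L[ℂ] H) →L[ℝ] ℝ :=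
    RCLike.reCLM.comp (((innerSL ℂ x).comp
      (ContinuousLinearMap.apply ℂ H x)).restrictScalars ℝ)
  exact L.hasFDerivAt.comp_hasDerivAt s h

theorem le_of_forall_re_inner_le {S T : H →L[ℂ] H} (hS : IsSelfAdjoint S) (hT : IsSelfAdjoint T)
    (h : ∀ x, RCLike.re ⟪x, S x⟫_ℂ ≤ RCLike.re ⟪x, T x⟫_ℂ) : S ≤ T := by
  rw [ContinuousLinearMap.le_def, ContinuousLinearMap.isPositive_def]
  refine ⟨ContinuousLinearMap.isSelfAdjoint_iff_isSymmetric.1 (hT.sub hS), fun x => ?_⟩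
  rw [ContinuousLinearMap.reApplyInnerSelf_apply, sub_apply, inner_sub_left, map_sub,
    inner_re_symm, inner_re_symm (S x)]
  exact sub_nonneg.2 (h x)

/-- For fixed `x` this is the mean value theorem for a scalar function with decreasing derivative.
-/
theorem re_inner_sub_mem_of_concave (h' : ∀ r ∈ Ioo s₁ s₂, HasDerivAt F (F' r) r)
    (h'' : ∀ r ∈ Ioo s₁ s₂, HasDerivAt F' (F'' r) r) (hneg : ∀ r ∈ Ioo s₁ s₂, F'' r ≤ 0)
    (hs : s ∈ Ioo s₁ s₂) (ht : t ∈ Ioo s₁ s₂) (hst : s < t) (x : H) :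
    (t - s) * RCLike.re ⟪x, F' t x⟫_ℂ ≤ RCLike.re ⟪x, F t x⟫_ℂ - RCLike.re ⟪x, F s x⟫_ℂ ∧
      RCLike.re ⟪x, F t x⟫_ℂ - RCLike.re ⟪x, F s x⟫_ℂ ≤ (t - s) * RCLike.re ⟪x, F' s x⟫_ℂ := by
  have hd1 (r) (hr : r ∈ Ioo s₁ s₂) := hasDerivAt_re_inner (h' r hr) x
  have hd2 (r) (hr : r ∈ Ioo s₁ s₂) := hasDerivAt_re_inner (h'' r hr) x
  have hanti : AntitoneOn (fun r => RCLike.re ⟪x, F' r x⟫_ℂ) (Ioo s₁ s₂) := by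
    refine antitoneOn_of_deriv_nonpos (convex_Ioo _ _)
      (fun r hr => (hd2 r hr).continuousAt.continuousWithinAt)
      (fun r hr => ?_) fun r hr => ?_
    · rw [interior_Ioo] at hr
      exact (hd2 r hr).differentiableAt.differentiableWithinAt
    · rw [interior_Ioo] at hr
      rw [(hd2 r hr).deriv]
      simpa using re_inner_le_of_le (hneg r hr) x
  have hsub : Icc s t ⊆ Ioo s₁ s₂ := fun r hr => ⟨hs.1.trans_le hr.1, hr.2.trans_lt ht.2⟩
  obtain ⟨ξ, hξ, e⟩ := exists_hasDerivAt_eq_slope (fun r => RCLike.re ⟪x, F r x⟫_ℂ)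
    (fun r => RCLike.re ⟪x, F' r x⟫_ℂ) hst
    (fun r hr => (hd1 r (hsub hr)).continuousAt.continuousWithinAt)
    fun r hr => hd1 r (hsub (Ioo_subset_Icc_self hr))
  have hpos : 0 < t - s := sub_pos.2 hst
  rw [eq_div_iff hpos.ne'] at e
  have hξ' := hsub (Ioo_subset_Icc_self hξ)
  have i1 := hanti hs hξ' hξ.1.le
  have i2 := hanti hξ' ht hξ.2.le
  simp only at i1 i2
  rw [← e]
  constructor <;> nlinarith

theorem smul_deriv_le_sub_and_le (h' : ∀ r ∈ Ioo s₁ s₂, HasDerivAt F (F' r) r)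
    (h'' : ∀ r ∈ Ioo s₁ s₂, HasDerivAt F' (F'' r) r) (hneg : ∀ r ∈ Ioo s₁ s₂, F'' r ≤ 0)
    (hF : ∀ r ∈ Ioo s₁ s₂, IsSelfAdjoint (F r)) (hF' : ∀ r ∈ Ioo s₁ s₂, IsSelfAdjoint (F' r))
    (hs : s ∈ Ioo s₁ s₂) (ht : t ∈ Ioo s₁ s₂) (hst : s < t) :
    (t - s) • F' t ≤ F t - F s ∧ F t - F s ≤ (t - s) • F' s := by
  have hsmul (r : ℝ) {T : H →L[ℂ] H} (hT : IsSelfAdjoint T) : IsSelfAdjoint (r • T) :=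
    (IsSelfAdjoint.all r).smul hT
  have hre (r : ℝ) (T : H →L[ℂ] H) (x : H) :
      RCLike.re ⟪x, (r • T) x⟫_ℂ = r * RCLike.re ⟪x, T x⟫_ℂ := by
    simp [inner_smul_right_eq_smul]
  have hcc := re_inner_sub_mem_of_concave h' h'' hneg hs ht hst
  have hW := (hF t ht).sub (hF s hs)
  constructor
  · refine le_of_forall_re_inner_le (hsmul _ (hF' t ht)) hW fun x => ?_
    rw [hre, sub_apply, inner_sub_right, map_sub]
    exact (hcc x).1
  · refine le_of_forall_re_inner_le hW (hsmul _ (hF' s hs)) fun x => ?_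
    rw [hre, sub_apply, inner_sub_right, map_sub]
    exact (hcc x).2

/-- The chain is `c tr(D' P') ≤ tr(W P') ≤ tr(W P) ≤ c tr(D P)`, the outer steps because the trace
of a product of two positive operators is nonnegative. -/
theorem re_diagSum_mul_le_of_smul_le {ι : Type*} {b : HilbertBasis ι ℂ H}
    {W D D' P P' : H →L[ℂ] H} {c : ℝ} (hc : 0 < c) (hW : IsNuclear b W) (hD : IsNuclear b D)
    (hD' : IsNuclear b D') (hP : 0 ≤ P) (hP' : 0 ≤ P') (hlower : c • D' ≤ W) (hupper : W ≤ c • D)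
    (h : 0 ≤ (diagSum b (W * (P - P'))).re) :
    (diagSum b (D' * P')).re ≤ (diagSum b (D * P)).re := by
  rw [hW.diagSum_mul_sub, Complex.sub_re] at h
  have hNs := hD.smul hc.le
  have hNt := hD'.smul hc.le
  have i1 := (hNs.sub hW).re_diagSum_mul_nonneg (sub_nonneg.2 hupper) hP
  have i2 := (hW.sub hNt).re_diagSum_mul_nonneg (sub_nonneg.2 hlower) hP'
  rw [sub_eq_add_neg, hNs.diagSum_add_mul hW.neg, neg_mul, diagSum_neg, smul_mul_assoc,
    diagSum_smul, Complex.add_re, Complex.neg_re, Complex.re_ofReal_mul] at i1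
  rw [sub_eq_add_neg, hW.diagSum_add_mul hNt.neg, neg_mul, diagSum_neg, smul_mul_assoc,
    diagSum_smul, Complex.add_re, Complex.neg_re, Complex.re_ofReal_mul] at i2
  refine le_of_mul_le_mul_left ?_ hc
  linarith

/-- Existence of a spectral measure rules out the default value `0`. Uniqueness plays no role, as
the trace inequality holds for any choice of spectral measures. -/
theorem exists_spectralProjection_eq {A : H →ₗ.[ℂ] H} (hA : IsMaximalSymmetric A) :
    ∃ E : ProjectionValuedMeasure H, E.IsSpectralMeasureOf A ∧
      ∀ B, spectralProjection A B = E.proj B := by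
  have h := hA.exists_isSpectralMeasureOf
  refine ⟨h.choose, h.choose_spec, fun B => ?_⟩
  rw [spectralProjection, dif_pos h]

end Concave

end TraceMonotonicity

end

/-! ### The monotonicity theorem -/

open TraceMonotonicity in
theorem theorem1p7 {H : Type*} [NormedAddCommGroup H] [InnerProductSpace ℂ H] [CompleteSpace H]
    [TopologicalSpace.SeparableSpace H]
    (H₀ : H →ₗ.[ℂ] H) (hH₀ : IsSelfAdjoint H₀)
    (s₁ s₂ : ℝ) (V V' V'' : ℝ → H →L[ℂ] H)
    (hV_selfAdjoint : ∀ s ∈ Set.Ioo s₁ s₂, IsSelfAdjoint (V s))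
    (hV : IsTraceNormC1On V V' (Set.Ioo s₁ s₂))
    (hV' : IsTraceNormC1On V' V'' (Set.Ioo s₁ s₂))
    (hV_concave : ∀ s ∈ Set.Ioo s₁ s₂, V'' s ≤ 0)
    (μ : ℝ) :
    (∀ s ∈ Set.Ioo s₁ s₂,
      IsTraceClass (V' s * spectralProjection (perturb H₀ (V s)) (Set.Iio μ)) ∧
      (opTrace (V' s * spectralProjection (perturb H₀ (V s)) (Set.Iio μ))).im = 0) ∧
    AntitoneOn
      (fun s => (opTrace (V' s * spectralProjection (perturb H₀ (V s)) (Set.Iio μ))).re)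
      (Set.Ioo s₁ s₂) := by
  have hH₀' := isMaximalSymmetric_of_isSelfAdjoint hH₀
  have hmax (s) (hs : s ∈ Set.Ioo s₁ s₂) : IsMaximalSymmetric (perturb H₀ (V s)) :=
    hH₀'.perturb (hV_selfAdjoint s hs)
  have hd1 (s) (hs : s ∈ Set.Ioo s₁ s₂) := hasDerivAt_of_hasTraceNormDerivAt (hV.hasDeriv s hs)
  have hd2 (s) (hs : s ∈ Set.Ioo s₁ s₂) := hasDerivAt_of_hasTraceNormDerivAt (hV'.hasDeriv s hs)
  have hsa' (s) (hs : s ∈ Set.Ioo s₁ s₂) : IsSelfAdjoint (V' s) :=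
    isSelfAdjoint_of_hasDerivAt (hd1 s hs)
      (Filter.eventually_of_mem (Ioo_mem_nhds hs.1 hs.2) hV_selfAdjoint)
  have hN (s) (hs : s ∈ Set.Ioo s₁ s₂) : IsNuclear (stdBasis H) (V s) :=
    isNuclear_of_isTraceClass (hV_selfAdjoint s hs) (hV.isTraceClass s hs)
  have hN' (s) (hs : s ∈ Set.Ioo s₁ s₂) : IsNuclear (stdBasis H) (V' s) :=
    isNuclear_of_isTraceClass (hsa' s hs) (hV'.isTraceClass s hs)
  have htr (T : H →L[ℂ] H) : opTrace T = diagSum (stdBasis H) T := rfl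
  refine ⟨fun s hs => ⟨(hN' s hs).isTraceClass_mul _, ?_⟩, fun s hs t ht hst => ?_⟩
  · obtain ⟨E, -, hE⟩ := exists_spectralProjection_eq (hmax s hs)
    -- Conjugating `tr(V' P)` replaces `P` by its adjoint, which is `P`.
    rw [hE, htr, ← Complex.conj_eq_iff_im, (hN' s hs).conj_diagSum_mul,
      (E.isSelfAdjoint_proj measurableSet_Iio).star_eq]
  rcases hst.eq_or_lt with rfl | hlt
  · exact le_rfl
  obtain ⟨E, hE, hEp⟩ := exists_spectralProjection_eq (hmax s hs)
  obtain ⟨E', hE', hEp'⟩ := exists_spectralProjection_eq (hmax t ht)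
  have hW := (hN t ht).sub (hN s hs)
  have hkey := re_diagSum_mul_proj_sub_nonneg hE hE' (hmax s hs).symm (hmax t ht).symm
    (hmax s hs).dense rfl hW (fun x h h' => by
      change V t x + H₀ ⟨x, h⟩ = V s x + H₀ ⟨x, h⟩ + (V t - V s) x
      rw [sub_apply]
      abel) μ
  have hcc := smul_deriv_le_sub_and_le hd1 hd2 hV_concave hV_selfAdjoint hsa' hs ht hlt
  simp only [hEp, hEp', htr]
  exact re_diagSum_mul_le_of_smul_le (sub_pos.2 hlt) hW (hN' s hs) (hN' t ht)
    (E.isStarProjection _ measurableSet_Iio).nonneg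
    (E'.isStarProjection _ measurableSet_Iio).nonneg hcc.1 hcc.2 hkey
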